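/- **Theorem 3.1 (Cubature rule for unitary Jacobi ensembles).** Let $m\ge 0$, $n\ge 1$, $d,\tilde d\ge 0$ be integers, let $\epsilon_\pm,\tilde\epsilon_\pm\in\{0,1\}$, and let $a_1,\dots,a_d$ and $\tilde a_1,\dots,\tilde a_{\tilde d}$ be complex parameters with $|a_r|<1$ and $|\tilde a_r|<1$, such that in each of the two families the non-real parameters occur in complex conjugate pairs. Put $$d_\epsilon:=\tfrac12(d-\epsilon_+-\epsilon_-),\qquad \tilde d_{\tilde\epsilon}:=\tfrac12(\tilde d-\tilde\epsilon_+-\tilde\epsilon_-),\qquad u_a(\theta):=\frac{1-a^2}{1-2a\cos\theta+a^2},$$ and assume that $$m+n-1>\lceil d_\epsilon\rceil+\lceil\tilde d_{\tilde\epsilon}\rceil .$$ Then for each $l\in\{0,\dots,m+n-1\}$ the equation $$2\bigl(m+n-1-d_\epsilon-\tilde d_{\tilde\epsilon}\bigr)\xi+\sum_{r=1}^{d}\int_0^{\xi}u_{a_r}(\theta)\,d\theta+\sum_{r=1}^{\tilde d}\int_0^{\xi}u_{\tilde a_r}(\theta)\,d\theta=\pi\,(2l+\epsilon_-+\tilde\epsilon_-)$$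 has a unique real solution $\xi=\xi_l$, and $0\le\xi_0<\xi_1<\cdots<\xi_{m+n-1}\le\pi$. Let $$\Delta_l:=\left(\tfrac12\right)^{(1-\epsilon_-)(1-\tilde\epsilon_-)\delta_{l}+(1-\epsilon_+)(1-\tilde\epsilon_+)\delta_{m+n-1-l}}\Bigl(2\bigl(m+n-1-d_\epsilon-\tilde d_{\tilde\epsilon}\bigr)+\sum_{r=1}^{d}u_{a_r}(\xi_l)+\sum_{r=1}^{\tilde d}u_{\tilde a_r}(\xi_l)\Bigr)^{-1},$$ where $\delta_0=1$ and $\delta_k=0$ for $k\ne 0$. For $\boldsymbol\xi=(\xi_1,\dots,\xi_n)\in[0,\pi]^n$ let $$\rho_\epsilon(\boldsymbol\xi):=\prod_{1\le j\le n}2^{\epsilon_++\epsilon_-}(1+\epsilon_+\cos\xi_j)(1-\epsilon_-\cos\xi_j)\prod_{1\le j<k\le n}(\cos\xi_j-\cos\xi_k)^2 .$$ Let $\Lambda^{(m,n)}:=\{\lambda\in\mathbb Z^n\mid m\ge\lambda_1\ge\cdots\ge\lambda_n\ge 0\}$, and for $\lambda\in\Lambda^{(m,n)}$ let $$\boldsymbol\xi_\lambda:=\bigl(\xi_{\lambda_1+n-1},\xi_{\lambda_2+n-2},\dots,\xi_{\lambda_n}\bigr),\qquad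 \Delta_\lambda:=\prod_{j=1}^{n}\Delta_{\lambda_j+n-j}.$$ Then $$\frac{1}{(2\pi)^n\,n!}\int_0^\pi\!\!\cdots\int_0^\pi R(\boldsymbol\xi)\,\rho_\epsilon(\boldsymbol\xi)\,d\xi_1\cdots d\xi_n=\sum_{\lambda\in\Lambda^{(m,n)}}R(\boldsymbol\xi_\lambda)\,\rho_\epsilon(\boldsymbol\xi_\lambda)\,\Delta_\lambda$$ for every function of the form $$R(\boldsymbol\xi)=\frac{f(\cos\xi_1,\dots,\cos\xi_n)}{\prod_{1\le r\le d,\ 1\le j\le n}\bigl(1-2a_r\cos\xi_j+a_r^2\bigr)},$$ where $f$ is a symmetric polynomial in $n$ variables with complex coefficients, of degree at most $\mathtt D:=2m+\tilde\epsilon_++\tilde\epsilon_--\tilde d-1$ in each variable. -/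

import Mathlib

open MeasureTheory

noncomputable section

namespace JacobiCubature

/-- The non-real entries of the finite family `a` come in complex conjugate pairs: the family is
invariant, with multiplicities, under complex conjugation. -/
def ConjInvariant {d : ℕ} (a : Fin d → ℂ) : Prop :=
  ∃ σ : Equiv.Perm (Fin d), ∀ r, (starRingEnd ℂ) (a r) = a (σ r)

/-- `d_ε = (d - ε₊ - ε₋) / 2`. -/
def halfDefect (d εp εm : ℕ) : ℝ := ((d : ℝ) - εp - εm) / 2

/-- `u_a(θ) = (1 - a²) / (1 - 2 a cos θ + a²)`. -/
def u (a : ℂ) (θ : ℝ) : ℂ :=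
  (1 - a ^ 2) / (1 - 2 * a * (Real.cos θ : ℂ) + a ^ 2)

/-- The transcendental equation for the node with label `l` in the rule with `N` nodes. -/
def NodeEq {d d' : ℕ} (a : Fin d → ℂ) (a' : Fin d' → ℂ) (εp εm ηp ηm N l : ℕ) (x : ℝ) : Prop :=
  ((2 * ((N : ℝ) - 1 - halfDefect d εp εm - halfDefect d' ηp ηm) * x : ℝ) : ℂ)
      + (∑ r, ∫ θ in (0 : ℝ)..x, u (a r) θ)
      + (∑ r, ∫ θ in (0 : ℝ)..x, u (a' r) θ)
    = ((Real.pi * (2 * (l : ℝ) + εm + ηm) : ℝ) : ℂ)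

/-- The one-variable Christoffel weight with label `l` in the rule with `N` nodes, where `x` is
the node with label `l`. -/
def weight {d d' : ℕ} (a : Fin d → ℂ) (a' : Fin d' → ℂ) (εp εm ηp ηm N l : ℕ) (x : ℝ) : ℂ :=
  (1 / 2 : ℂ) ^ ((1 - εm) * (1 - ηm) * (if l = 0 then 1 else 0)
      + (1 - εp) * (1 - ηp) * (if l + 1 = N then 1 else 0))
    * (((2 * ((N : ℝ) - 1 - halfDefect d εp εm - halfDefect d' ηp ηm) : ℝ) : ℂ)
      + (∑ r, u (a r) x) + (∑ r, u (a' r) x))⁻¹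

/-- The unnormalized density of the unitary Jacobi ensemble. -/
def density (εp εm : ℕ) {n : ℕ} (ξ : Fin n → ℝ) : ℝ :=
  (∏ j, 2 ^ (εp + εm) * (1 + εp * Real.cos (ξ j)) * (1 - εm * Real.cos (ξ j)))
    * ∏ j, ∏ k ∈ Finset.Ioi j, (Real.cos (ξ j) - Real.cos (ξ k)) ^ 2

/-- The function `R(ξ) = f(cos ξ₁, …, cos ξₙ) / ∏_{r,j} (1 - 2 a_r cos ξ_j + a_r²)`. -/
def ratFun {d n : ℕ} (a : Fin d → ℂ) (f : MvPolynomial (Fin n) ℂ) (ξ : Fin n → ℝ) : ℂ :=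
  MvPolynomial.eval (fun j => (Real.cos (ξ j) : ℂ)) f
    / ∏ r, ∏ j, (1 - 2 * a r * (Real.cos (ξ j) : ℂ) + a r ^ 2)

/-- The symmetric polynomials in `n` variables of degree at most `D` in each variable. -/
def SymPolyDegLE (D : ℤ) {n : ℕ} (f : MvPolynomial (Fin n) ℂ) : Prop :=
  f.IsSymmetric ∧ ∀ j, (f.degreeOf j : ℤ) ≤ D

open Classical in
/-- `Λ^{(m,n)} = {λ | m ≥ λ₁ ≥ ⋯ ≥ λₙ ≥ 0}`. -/
def partitions (m n : ℕ) : Finset (Fin n → ℕ) :=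
  (Fintype.piFinset fun _ => Finset.range (m + 1)).filter fun lam => Antitone lam

/-- The shifted part `λ_j + n - j` (with `j` counted from `1`). It is less than `m + n` for `λ` in
`partitions m n`. -/
def shifted {n : ℕ} (lam : Fin n → ℕ) (j : Fin n) : ℕ := lam j + (n - 1 - j)

end JacobiCubature

end

open MeasureTheory

noncomputable section

namespace JacobiCubature

/-! Put z = e^{iξ} and let b run over both parameter families. The coefficient of ξ in the node
equation is a positive integer M, and its left side is the phase of the Blaschke product B(z) = z^M
∏ (z - b)/(1 - bz), of degree K = M + d + d'. Conjugation invariance makes the sum of the u_b real,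
and each u_b has positive real part, so the phase is real, odd and strictly increasing, and grows by
2πK per turn. This yields the nodes, their uniqueness, order and range. On the circle, the labels 0,
…, K - 1 give exactly the roots of B(z) = s for a sign s.

These roots are the zeros of the monic polynomial Q = z^M ∏ (z - b) - s ∏ (1 - bz), with Q(0) = -s.
Lagrange interpolation of H at them, evaluated at 0, recovers H(0) from the values of H/∏ (1 - bz),
with the reciprocals of the phase derivative as weights (`sum_eval_div_phaseDeriv`). By the mean
value property such values at 0 are circle averages. A rational function of cos ξ splits into a part
holomorphic inside and one holomorphic outside (`exists_split`); reflection reduces the second to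
the first (`circle_quadrature`). Folding along ξ ↦ -ξ leaves m + n labels, with half weight at a
node fixed by the reflection (`sum_range_fold`, `interval_quadrature`).

In n variables the integrand is f times a squared Vandermonde times a product weight, and its degree
in each variable is within the exactness of the one-variable rule. The product rule
(`product_quadrature`) has a symmetric summand that vanishes when two labels coincide, so it is n!
times a sum over strictly decreasing label tuples, which are the shifted partitions. -/

/-- The point `e^{iθ}` of the unit circle. -/
def circlePt (θ : ℝ) : ℂ := Complex.exp (θ * Complex.I)

lemma norm_circlePt (θ : ℝ) : ‖circlePt θ‖ = 1 := Complex.norm_exp_ofReal_mul_I θ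

lemma circlePt_ne_zero (θ : ℝ) : circlePt θ ≠ 0 := Complex.exp_ne_zero _

lemma circlePt_neg (θ : ℝ) : circlePt (-θ) = (circlePt θ)⁻¹ := by
  simp [circlePt, Complex.exp_neg]

lemma circlePt_zero : circlePt 0 = 1 := by simp [circlePt]

lemma circlePt_add_two_pi (θ : ℝ) : circlePt (θ + 2 * Real.pi) = circlePt θ := by
  simp [circlePt, add_mul, Complex.exp_add]

lemma cos_eq_circlePt (θ : ℝ) : (Real.cos θ : ℂ) = (circlePt θ + (circlePt θ)⁻¹) / 2 := by
  rw [Complex.ofReal_cos, Complex.cos, circlePt, ← Complex.exp_neg, neg_mul]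

lemma hasDerivAt_circlePt (θ : ℝ) :
    HasDerivAt circlePt (Complex.I * circlePt θ) θ := by
  have h : HasDerivAt (fun t : ℝ => (t : ℂ) * Complex.I) (1 * Complex.I) θ :=
    Complex.ofRealCLM.hasDerivAt.mul_const _
  refine h.cexp.congr_deriv ?_
  rw [circlePt]; ring

lemma continuous_circlePt : Continuous circlePt := by
  unfold circlePt; fun_prop

lemma one_sub_mul_ne_zero {b z : ℂ} (hb : ‖b‖ < 1) (hz : ‖z‖ ≤ 1) : 1 - b * z ≠ 0 := by
  intro h
  have h1 : ‖b * z‖ = 1 := by rw [← sub_eq_zero.1 h]; simp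
  rw [norm_mul] at h1
  nlinarith [norm_nonneg b, norm_nonneg z]

lemma sub_ne_zero_of_norm {b z : ℂ} (hb : ‖b‖ < 1) (hz : ‖z‖ = 1) : z - b ≠ 0 := by
  intro h
  rw [sub_eq_zero.1 h] at hz
  linarith

/-! ### The kernel u_b and Blaschke factors -/

lemma denom_eq (b : ℂ) (θ : ℝ) :
    1 - 2 * b * (Real.cos θ : ℂ) + b ^ 2
      = (1 - b * circlePt θ) * (1 - b * (circlePt θ)⁻¹) := by
  rw [cos_eq_circlePt]
  have := circlePt_ne_zero θ
  field_simp
  ring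

lemma one_sub_circlePt_ne {b : ℂ} (hb : ‖b‖ < 1) (θ : ℝ) : 1 - b * circlePt θ ≠ 0 :=
  one_sub_mul_ne_zero hb (norm_circlePt θ).le

lemma one_sub_circlePt_inv_ne {b : ℂ} (hb : ‖b‖ < 1) (θ : ℝ) : 1 - b * (circlePt θ)⁻¹ ≠ 0 :=
  one_sub_mul_ne_zero hb (by simp [norm_circlePt])

lemma denom_ne_zero {b : ℂ} (hb : ‖b‖ < 1) (θ : ℝ) :
    1 - 2 * b * (Real.cos θ : ℂ) + b ^ 2 ≠ 0 := by
  rw [denom_eq]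
  exact mul_ne_zero (one_sub_circlePt_ne hb θ) (one_sub_circlePt_inv_ne hb θ)

lemma u_eq_poisson {b : ℂ} (hb : ‖b‖ < 1) (θ : ℝ) :
    u b θ = 1 / (1 - b * circlePt θ) + 1 / (1 - b * (circlePt θ)⁻¹) - 1 := by
  rw [u, denom_eq]
  have h0 := circlePt_ne_zero θ
  have h1 := one_sub_circlePt_ne hb θ
  have h2 := one_sub_circlePt_inv_ne hb θ
  rw [eq_sub_iff_add_eq, div_add_div _ _ h1 h2, ← sub_eq_zero]
  rw [div_add_one (mul_ne_zero h1 h2), ← sub_div, div_eq_zero_iff]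
  left
  field_simp
  ring

lemma u_eq_logDeriv {b : ℂ} (hb : ‖b‖ < 1) (θ : ℝ) :
    u b θ = circlePt θ / (circlePt θ - b) + b * circlePt θ / (1 - b * circlePt θ) := by
  rw [u_eq_poisson hb]
  have h0 := circlePt_ne_zero θ
  have h1 := one_sub_circlePt_ne hb θ
  have h2 := sub_ne_zero_of_norm hb (norm_circlePt θ)
  have h3 : 1 - b * (circlePt θ)⁻¹ = (circlePt θ - b) / circlePt θ := by field_simp
  rw [h3, one_div_div]
  have h4 : (1 : ℂ) / (1 - b * circlePt θ) = 1 + b * circlePt θ / (1 - b * circlePt θ) := by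
    field_simp; ring
  rw [h4]; ring

lemma continuous_u {b : ℂ} (hb : ‖b‖ < 1) : Continuous (u b) := by
  unfold u
  refine Continuous.div (by fun_prop) (by fun_prop) (fun θ => denom_ne_zero hb θ)

/-- The Möbius map w ↦ 1/(1 - w) carries the unit disc onto this half-plane. Applied at bz and b/z,
it makes the real part of u_b positive even for non-real b. -/
lemma half_lt_re_inv {w : ℂ} (hw : ‖w‖ < 1) : 1 / 2 < (1 / (1 - w)).re := by
  have h0 : 0 < Complex.normSq (1 - w) := by
    rw [Complex.normSq_pos]
    intro h
    rw [← sub_eq_zero.1 h] at hw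
    simp at hw
  have h1 : Complex.normSq w < 1 := by
    rw [Complex.normSq_eq_norm_sq]
    nlinarith [norm_nonneg w]
  rw [one_div (1 - w), Complex.inv_re, lt_div_iff₀ h0]
  simp only [Complex.normSq_apply, Complex.sub_re, Complex.one_re, Complex.sub_im,
    Complex.one_im] at *
  linarith

lemma u_re_pos {b : ℂ} (hb : ‖b‖ < 1) (θ : ℝ) : 0 < (u b θ).re := by
  rw [u_eq_poisson hb]
  have h1 := half_lt_re_inv (w := b * circlePt θ) (by simpa [norm_circlePt] using hb)
  have h2 := half_lt_re_inv (w := b * (circlePt θ)⁻¹) (by simpa [norm_circlePt] using hb)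
  simp only [Complex.sub_re, Complex.add_re, Complex.one_re]
  linarith

lemma conj_u (b : ℂ) (θ : ℝ) : (starRingEnd ℂ) (u b θ) = u ((starRingEnd ℂ) b) θ := by
  simp only [u, map_div₀, map_sub, map_add, map_mul, map_pow, map_one, map_ofNat,
    Complex.conj_ofReal]

lemma u_neg (b : ℂ) (θ : ℝ) : u b (-θ) = u b θ := by simp [u]

lemma u_add_two_pi (b : ℂ) (θ : ℝ) : u b (θ + 2 * Real.pi) = u b θ := by simp [u]

/-- Conjugation only permutes the summands. This is where the conjugate-pair hypothesis enters; it
makes the phase real. -/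
lemma sum_u_eq_ofReal {d : ℕ} {b : Fin d → ℂ} (hc : ConjInvariant b) (θ : ℝ) :
    ∑ i, u (b i) θ = ((∑ i, (u (b i) θ).re : ℝ) : ℂ) := by
  obtain ⟨σ, hσ⟩ := hc
  have h : (starRingEnd ℂ) (∑ i, u (b i) θ) = ∑ i, u (b i) θ := by
    rw [map_sum]
    simp_rw [conj_u, hσ]
    exact Equiv.sum_comp σ (fun i => u (b i) θ)
  rw [← Complex.re_sum]
  exact (Complex.conj_eq_iff_re.1 h).symm

/-- `e^{i ∫₀ˣ u_b}` is the Blaschke factor of `b`, normalized to be `1` at `1`. -/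
lemma cexp_integral_u {b : ℂ} (hb : ‖b‖ < 1) (x : ℝ) :
    Complex.exp (Complex.I * ∫ θ in (0 : ℝ)..x, u b θ)
      = (circlePt x - b) / (1 - b * circlePt x) := by
  -- The quotient of the two sides; it is constant because u_b is z times the logarithmic derivative
  -- of the Blaschke factor.
  set F : ℝ → ℂ := fun x => Complex.exp (-(Complex.I * ∫ θ in (0 : ℝ)..x, u b θ))
    * ((circlePt x - b) / (1 - b * circlePt x)) with hF
  have hd : ∀ x, HasDerivAt F 0 x := by
    intro x
    have hI : HasDerivAt (fun x => ∫ θ in (0 : ℝ)..x, u b θ) (u b x) x :=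
      intervalIntegral.integral_hasDerivAt_right ((continuous_u hb).intervalIntegrable _ _)
        (continuous_u hb).stronglyMeasurable.stronglyMeasurableAtFilter
        (continuous_u hb).continuousAt
    have h1 := one_sub_circlePt_ne hb x
    have h2 := sub_ne_zero_of_norm hb (norm_circlePt x)
    have hz := hasDerivAt_circlePt x
    have hq := (hz.sub_const b).div ((hz.const_mul b).const_sub 1) h1
    have hm := ((hI.const_mul Complex.I).neg.cexp).mul hq
    refine HasDerivAt.congr_deriv (f' := _) hm ?_
    simp only [Pi.neg_apply, Pi.div_apply]
    rw [u_eq_logDeriv hb]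
    have h3 : 1 - circlePt x * b ≠ 0 := by rwa [mul_comm]
    field_simp
    ring
  have hc := is_const_of_deriv_eq_zero (fun x => (hd x).differentiableAt)
    (fun x => (hd x).deriv) x 0
  have h0 : F 0 = 1 := by
    have h1 : (1 : ℂ) - b ≠ 0 := by simpa using one_sub_mul_ne_zero (z := 1) hb (by simp)
    simp [hF, circlePt_zero, h1]
  rw [h0] at hc
  simp only [hF, Complex.exp_neg] at hc
  have := Complex.exp_ne_zero (Complex.I * ∫ θ in (0 : ℝ)..x, u b θ)
  rw [inv_mul_eq_iff_eq_mul₀ this, mul_one] at hc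
  exact hc.symm

/-- The mean value property of holomorphic functions. -/
lemma integral_zero_two_pi_of_holomorphic {f : ℂ → ℂ}
    (hf : DifferentiableOn ℂ f (Metric.closedBall 0 1)) :
    ∫ θ in (0 : ℝ)..(2 * Real.pi), f (circlePt θ) = 2 * Real.pi * f 0 := by
  have h : DiffContOnCl ℂ f (Metric.ball 0 |(1 : ℝ)|) := by
    rw [abs_one]
    refine DifferentiableOn.diffContOnCl ?_
    rwa [closure_ball _ one_ne_zero]
  have h1 := h.circleAverage
  rw [Real.circleAverage_def] at h1
  have h2 : (2 * Real.pi : ℂ) ≠ 0 := by simp [Real.pi_ne_zero]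
  rw [← h1, Complex.real_smul]
  push_cast
  rw [mul_inv_cancel_left₀ h2]
  simp [circleMap, circlePt]

lemma integral_zero_two_pi_comp_neg (f : ℝ → ℂ) (hf : ∀ θ, f (θ + 2 * Real.pi) = f θ) :
    ∫ θ in (0 : ℝ)..(2 * Real.pi), f (-θ) = ∫ θ in (0 : ℝ)..(2 * Real.pi), f θ := by
  rw [intervalIntegral.integral_comp_neg]
  have := Function.Periodic.intervalIntegral_add_eq (f := f) (T := 2 * Real.pi) hf
    (-(2 * Real.pi)) 0
  simpa using this

/-- Both terms 1/(1 - bz) and 1/(1 - b/z) have mean 1 over the circle, the second by reflection. -/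
lemma integral_u_two_pi {b : ℂ} (hb : ‖b‖ < 1) :
    ∫ θ in (0 : ℝ)..(2 * Real.pi), u b θ = 2 * Real.pi := by
  have hd : DifferentiableOn ℂ (fun z : ℂ => 1 / (1 - b * z)) (Metric.closedBall 0 1) := by
    intro z hz
    refine DifferentiableAt.differentiableWithinAt ?_
    refine DifferentiableAt.div (by fun_prop) (by fun_prop)
      (one_sub_mul_ne_zero hb (by simpa using hz))
  have h1 := integral_zero_two_pi_of_holomorphic hd
  have h2 := integral_zero_two_pi_comp_neg (fun θ => 1 / (1 - b * circlePt θ))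
    (fun θ => by simp only [circlePt_add_two_pi])
  have c1 : Continuous fun θ => 1 / (1 - b * circlePt θ) :=
    Continuous.div (by fun_prop) (by have := continuous_circlePt; fun_prop)
      (fun θ => one_sub_circlePt_ne hb θ)
  have c2 : Continuous fun θ => 1 / (1 - b * circlePt (-θ)) := c1.comp continuous_neg
  simp_rw [u_eq_poisson hb, ← circlePt_neg]
  rw [intervalIntegral.integral_sub (f := fun θ => 1 / (1 - b * circlePt θ) + 1 / (1 - b * circlePt (-θ)))
      ((c1.add c2).intervalIntegrable _ _) (by simp),
    intervalIntegral.integral_add (c1.intervalIntegrable _ _) (c2.intervalIntegrable _ _), h2, h1]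
  simp

/-! ### The phase of a Blaschke product -/

section Phase

variable {ι : Type*} [Fintype ι]

/-- The derivative of the phase of the Blaschke product `z^M ∏ (z - b_i) / (1 - b_i z)`. -/
def phaseDeriv (b : ι → ℂ) (M : ℕ) (θ : ℝ) : ℝ := M + ∑ i, (u (b i) θ).re

/-- The phase of the Blaschke product `z^M ∏ (z - b_i) / (1 - b_i z)`. -/
def phase (b : ι → ℂ) (M : ℕ) (x : ℝ) : ℝ := ∫ θ in (0 : ℝ)..x, phaseDeriv b M θ

variable {b : ι → ℂ} {M : ℕ}

lemma continuous_phaseDeriv (hb : ∀ i, ‖b i‖ < 1) : Continuous (phaseDeriv b M) := by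
  unfold phaseDeriv
  exact continuous_const.add (continuous_finsetSum _ fun i _ =>
    Complex.continuous_re.comp (continuous_u (hb i)))

lemma phaseDeriv_pos (hb : ∀ i, ‖b i‖ < 1) (hM : 0 < M) (θ : ℝ) : 0 < phaseDeriv b M θ := by
  unfold phaseDeriv
  have : 0 ≤ ∑ i, (u (b i) θ).re := Finset.sum_nonneg fun i _ => (u_re_pos (hb i) θ).le
  have : (0 : ℝ) < M := by exact_mod_cast hM
  linarith

lemma phaseDeriv_neg (θ : ℝ) : phaseDeriv b M (-θ) = phaseDeriv b M θ := by
  simp [phaseDeriv, u_neg]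

lemma phaseDeriv_add_two_pi (θ : ℝ) :
    phaseDeriv b M (θ + 2 * Real.pi) = phaseDeriv b M θ := by
  simp [phaseDeriv, u_add_two_pi]

lemma hasDerivAt_phase (hb : ∀ i, ‖b i‖ < 1) (x : ℝ) :
    HasDerivAt (phase b M) (phaseDeriv b M x) x :=
  intervalIntegral.integral_hasDerivAt_right ((continuous_phaseDeriv hb).intervalIntegrable _ _)
    (continuous_phaseDeriv hb).stronglyMeasurable.stronglyMeasurableAtFilter
    (continuous_phaseDeriv hb).continuousAt

lemma strictMono_phase (hb : ∀ i, ‖b i‖ < 1) (hM : 0 < M) : StrictMono (phase b M) :=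
  strictMono_of_deriv_pos fun x => by
    rw [(hasDerivAt_phase hb x).deriv]; exact phaseDeriv_pos hb hM x

lemma continuous_phase (hb : ∀ i, ‖b i‖ < 1) : Continuous (phase b M) :=
  continuous_iff_continuousAt.2 fun x => (hasDerivAt_phase hb x).continuousAt

lemma phase_zero : phase b M 0 = 0 := by simp [phase]

lemma phase_neg (x : ℝ) : phase b M (-x) = -phase b M x := by
  have h := intervalIntegral.integral_comp_neg (a := 0) (b := x) (phaseDeriv b M)
  simp only [phaseDeriv_neg, neg_zero] at h
  rw [phase, phase, h, intervalIntegral.integral_symm]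

lemma phase_two_pi (hb : ∀ i, ‖b i‖ < 1) :
    phase b M (2 * Real.pi) = 2 * Real.pi * (M + Fintype.card ι : ℕ) := by
  have h : ∀ i, ∫ θ in (0 : ℝ)..(2 * Real.pi), (u (b i) θ).re = 2 * Real.pi := by
    intro i
    have h1 := Complex.reCLM.intervalIntegral_comp_comm
      ((continuous_u (hb i)).intervalIntegrable (μ := volume) 0 (2 * Real.pi))
    simp only [Complex.reCLM_apply] at h1
    rw [h1, integral_u_two_pi (hb i)]
    simp
  have hc : ∀ i, Continuous fun θ => (u (b i) θ).re := fun i =>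
    Complex.continuous_re.comp (continuous_u (hb i))
  have hi : ∀ i, IntervalIntegrable (fun θ => (u (b i) θ).re) volume 0 (2 * Real.pi) := fun i =>
    (hc i).intervalIntegrable _ _
  unfold phase phaseDeriv
  rw [intervalIntegral.integral_add (by simp)
      (Continuous.intervalIntegrable (continuous_finsetSum _ fun i _ => hc i) _ _),
    intervalIntegral.integral_finsetSum (fun i _ => hi i)]
  simp [h]
  ring

lemma phase_add_two_pi (hb : ∀ i, ‖b i‖ < 1) (x : ℝ) :
    phase b M (x + 2 * Real.pi) = phase b M x + 2 * Real.pi * (M + Fintype.card ι : ℕ) := by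
  have hi := fun x y => (continuous_phaseDeriv (M := M) hb).intervalIntegrable (μ := volume) x y
  rw [← phase_two_pi hb, phase, phase, phase,
    ← intervalIntegral.integral_add_adjacent_intervals (hi 0 x) (hi x _)]
  have := Function.Periodic.intervalIntegral_add_eq (f := phaseDeriv b M) (T := 2 * Real.pi)
    phaseDeriv_add_two_pi x 0
  simpa using this

lemma phase_pi (hb : ∀ i, ‖b i‖ < 1) :
    phase b M Real.pi = Real.pi * (M + Fintype.card ι : ℕ) := by
  have h := phase_add_two_pi (M := M) hb (-Real.pi)
  rw [phase_neg, show -Real.pi + 2 * Real.pi = Real.pi by ring] at h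
  linarith

/-- After subtraction of its linear growth the phase is 2π-periodic. -/
lemma phase_add_int_mul_two_pi (hb : ∀ i, ‖b i‖ < 1) (x : ℝ) (j : ℤ) :
    phase b M (x + j * (2 * Real.pi))
      = phase b M x + j * (2 * Real.pi * (M + Fintype.card ι : ℕ)) := by
  have hp : Function.Periodic
      (fun x => phase b M x - (M + Fintype.card ι : ℕ) * x) (2 * Real.pi) := by
    intro x
    simp only [phase_add_two_pi hb]
    ring
  have h := hp.int_mul j x
  linarith

lemma surjective_phase (hb : ∀ i, ‖b i‖ < 1) (hM : 0 < M) (y : ℝ) : ∃ x, phase b M x = y := by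
  have hK : (0 : ℝ) < 2 * Real.pi * (M + Fintype.card ι : ℕ) := by
    have : (0 : ℝ) < (M + Fintype.card ι : ℕ) := by exact_mod_cast (by omega)
    have := Real.pi_pos
    positivity
  obtain ⟨n, hn⟩ := exists_nat_gt (|y| / (2 * Real.pi * (M + Fintype.card ι : ℕ)))
  rw [div_lt_iff₀ hK] at hn
  have h1 := phase_add_int_mul_two_pi (M := M) hb 0 n
  have h2 := phase_add_int_mul_two_pi (M := M) hb 0 (-n)
  rw [phase_zero, zero_add] at h1 h2
  have h3 := abs_lt.1 hn
  have := mem_range_of_exists_le_of_exists_ge (c := y) (continuous_phase (M := M) hb)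
    ⟨_, (h2.trans_le (by push_cast at *; linarith))⟩
    ⟨_, (by push_cast at *; linarith : y ≤ _).trans h1.ge⟩
  exact this

lemma ofReal_phase (hb : ∀ i, ‖b i‖ < 1)
    (hr : ∀ θ, ∑ i, u (b i) θ = ((∑ i, (u (b i) θ).re : ℝ) : ℂ)) (x : ℝ) :
    (phase b M x : ℂ) = M * x + ∑ i, ∫ θ in (0 : ℝ)..x, u (b i) θ := by
  have hi : ∀ i, IntervalIntegrable (u (b i)) volume 0 x := fun i =>
    (continuous_u (hb i)).intervalIntegrable _ _
  rw [phase, ← intervalIntegral.integral_ofReal]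
  simp only [phaseDeriv, Complex.ofReal_add, ← hr, Complex.ofReal_natCast]
  rw [intervalIntegral.integral_add (by simp)
      (Continuous.intervalIntegrable (continuous_finsetSum _ fun i _ => continuous_u (hb i)) _ _),
    intervalIntegral.integral_finsetSum (fun i _ => hi i)]
  simp [mul_comm]

/-- `e^{i φ}` is the Blaschke product, for a family with real `∑ u_{b_i}`. -/
lemma cexp_phase (hb : ∀ i, ‖b i‖ < 1)
    (hr : ∀ θ, ∑ i, u (b i) θ = ((∑ i, (u (b i) θ).re : ℝ) : ℂ)) (x : ℝ) :
    Complex.exp (Complex.I * phase b M x)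
      = circlePt x ^ M * ∏ i, (circlePt x - b i) / (1 - b i * circlePt x) := by
  rw [ofReal_phase hb hr, mul_add, Complex.exp_add, Finset.mul_sum, Complex.exp_sum]
  congr 1
  · rw [circlePt, ← Complex.exp_nat_mul]
    congr 1; ring
  · exact Finset.prod_congr rfl fun i _ => cexp_integral_u (hb i) x

end Phase

/-! ### Interpolation at the level set of a Blaschke product -/

section Circle

open Polynomial

lemma eval_derivative_prod {κ : Type*} (s : Finset κ) (p : κ → ℂ[X]) (z : ℂ)
    (h : ∀ i ∈ s, (p i).eval z ≠ 0) :
    (derivative (∏ i ∈ s, p i)).eval z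
      = (∏ i ∈ s, (p i).eval z) * ∑ i ∈ s, (derivative (p i)).eval z / (p i).eval z := by
  classical
  induction s using Finset.induction_on with
  | empty => simp
  | insert i s hi ih =>
    have h1 := h i (Finset.mem_insert_self _ _)
    rw [Finset.prod_insert hi, derivative_mul, Finset.prod_insert hi, Finset.sum_insert hi,
      eval_add, eval_mul, eval_mul, ih (fun j hj => h j (Finset.mem_insert_of_mem hj)), eval_prod]
    field_simp

variable {ι : Type*} [Fintype ι]

/-- `∏ (1 - b_i X)`. -/
def outerPoly (b : ι → ℂ) : ℂ[X] := ∏ i, (1 - C (b i) * X)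

/-- `∏ (X - b_i)`. -/
def innerPoly (b : ι → ℂ) : ℂ[X] := ∏ i, (X - C (b i))

lemma eval_outerPoly (b : ι → ℂ) (z : ℂ) : (outerPoly b).eval z = ∏ i, (1 - b i * z) := by
  simp [outerPoly, eval_prod]

lemma eval_innerPoly (b : ι → ℂ) (z : ℂ) : (innerPoly b).eval z = ∏ i, (z - b i) := by
  simp [innerPoly, eval_prod]

lemma natDegree_outerPoly_le (b : ι → ℂ) : (outerPoly b).natDegree ≤ Fintype.card ι := by
  refine (natDegree_prod_le _ _).trans ?_
  refine (Finset.sum_le_card_nsmul _ _ 1 fun i _ => ?_).trans (by simp)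
  compute_degree

lemma monic_innerPoly (b : ι → ℂ) : (innerPoly b).Monic :=
  monic_prod_of_monic _ _ fun i _ => monic_X_sub_C (b i)

lemma natDegree_innerPoly (b : ι → ℂ) : (innerPoly b).natDegree = Fintype.card ι := by
  rw [innerPoly, natDegree_prod_of_monic _ _ fun i _ => monic_X_sub_C (b i)]
  simp

variable {b : ι → ℂ} {M : ℕ}

/-- At a root both terms of Q have the same value, so zQ' is this value times the difference of
their logarithmic derivatives, which on the circle is the phase derivative. -/
lemma eval_derivative_blaschke {s z : ℂ} (h1 : ∀ i, z - b i ≠ 0)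
    (h2 : ∀ i, 1 - b i * z ≠ 0)
    (hz : z ^ M * ∏ i, (z - b i) = s * ∏ i, (1 - b i * z)) :
    z * (derivative (X ^ M * innerPoly b - C s * outerPoly b)).eval z
      = s * (∏ i, (1 - b i * z))
        * (M + ∑ i, (z / (z - b i) + b i * z / (1 - b i * z))) := by
  have e1 : (derivative (innerPoly b)).eval z = (∏ i, (z - b i)) * ∑ i, 1 / (z - b i) := by
    rw [innerPoly, eval_derivative_prod _ _ _ (by simpa using h1)]
    simp
  have e2 : (derivative (outerPoly b)).eval z
      = (∏ i, (1 - b i * z)) * ∑ i, -b i / (1 - b i * z) := by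
    rw [outerPoly, eval_derivative_prod _ _ _ (by simpa using h2)]
    simp
  have e3 : z * (derivative (X ^ M : ℂ[X])).eval z = M * z ^ M := by
    rcases M with _ | M
    · simp
    · simp; ring
  rw [derivative_sub, derivative_mul, derivative_C_mul, eval_sub, eval_add, eval_mul, eval_mul,
    eval_C_mul, e1, e2, eval_innerPoly, eval_pow, eval_X, Finset.sum_add_distrib, mul_sub, mul_add,
    ← mul_assoc z, e3]
  have s1 : ∑ i, z / (z - b i) = z * ∑ i, 1 / (z - b i) := by
    rw [Finset.mul_sum]; simp [div_eq_mul_inv]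
  have s2 : ∑ i, b i * z / (1 - b i * z) = -(z * ∑ i, -b i / (1 - b i * z)) := by
    rw [Finset.mul_sum, ← Finset.sum_neg_distrib]
    exact Finset.sum_congr rfl fun i _ => by ring
  rw [s1, s2]
  linear_combination ((M : ℂ) + z * ∑ i, 1 / (z - b i)) * hz

/-- The quadrature rule on the circle at the points where the Blaschke product
`z^M ∏ (z - b_i) / (1 - b_i z)` has the value `s`, for functions holomorphic in the disc. -/
theorem sum_eval_div_phaseDeriv (hb : ∀ i, ‖b i‖ < 1) (hM : 0 < M)
    (hr : ∀ θ, ∑ i, u (b i) θ = ((∑ i, (u (b i) θ).re : ℝ) : ℂ)) {s : ℂ} (hs : s ≠ 0)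
    (t : ℕ → ℝ)
    (hinj : Set.InjOn (fun k => circlePt (t k)) (Finset.range (M + Fintype.card ι)))
    (hexp : ∀ k < M + Fintype.card ι, Complex.exp (Complex.I * phase b M (t k)) = s)
    (H : ℂ[X]) (hH : H.natDegree < M + Fintype.card ι) :
    ∑ k ∈ Finset.range (M + Fintype.card ι),
      H.eval (circlePt (t k)) / (outerPoly b).eval (circlePt (t k)) / (phaseDeriv b M (t k) : ℂ)
      = H.eval 0 := by
  set K := M + Fintype.card ι with hK
  set v : ℕ → ℂ := fun k => circlePt (t k) with hv
  have h1 : ∀ k i, v k - b i ≠ 0 := fun k i => sub_ne_zero_of_norm (hb i) (norm_circlePt _)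
  have h2 : ∀ k i, 1 - b i * v k ≠ 0 := fun k i => one_sub_circlePt_ne (hb i) _
  have hroot : ∀ k < K, v k ^ M * ∏ i, (v k - b i) = s * ∏ i, (1 - b i * v k) := by
    intro k hk
    have h := hexp k hk
    rw [cexp_phase hb hr, Finset.prod_div_distrib, ← mul_div_assoc,
      div_eq_iff (Finset.prod_ne_zero_iff.2 fun i _ => h2 k i)] at h
    exact h
  set Q : ℂ[X] := X ^ M * innerPoly b - C s * outerPoly b with hQ
  have hmon : (X ^ M * innerPoly b).Monic := (monic_X_pow M).mul (monic_innerPoly b)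
  have hdegN : (X ^ M * innerPoly b).natDegree = K := by
    rw [(monic_X_pow M).natDegree_mul (monic_innerPoly b), natDegree_innerPoly, natDegree_X_pow]
  -- Strict because M > 0; the same condition gives Q(0) = -s below.
  have hdeglt : (C s * outerPoly b).degree < (X ^ M * innerPoly b).degree := by
    rw [degree_eq_natDegree hmon.ne_zero, hdegN]
    refine lt_of_le_of_lt (degree_C_mul hs).le (lt_of_le_of_lt degree_le_natDegree ?_)
    exact_mod_cast lt_of_le_of_lt (natDegree_outerPoly_le b) (by omega)
  have hQm : Q.Monic := hmon.sub_of_left hdeglt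
  have hQd : Q.degree = K := by
    rw [hQ, degree_sub_eq_left_of_degree_lt hdeglt, degree_eq_natDegree hmon.ne_zero, hdegN]
  have hQn : Q = Lagrange.nodal (Finset.range K) v := by
    refine eq_of_degree_sub_lt_of_eval_index_eq (Finset.range K) hinj ?_ ?_
    · refine (degree_sub_lt_left ?_ hQm.ne_zero ?_).trans_le ?_
      · rw [hQd, Lagrange.degree_nodal, Finset.card_range]
      · rw [hQm.leadingCoeff, Lagrange.nodal_monic.leadingCoeff]
      · rw [hQd, Finset.card_range]
    · intro k hk
      rw [Lagrange.eval_nodal_at_node hk, hQ, eval_sub, eval_mul, eval_C_mul, eval_innerPoly,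
        eval_outerPoly, eval_pow, eval_X, hroot k (Finset.mem_range.1 hk), sub_self]
  have hQ0 : Q.eval 0 = -s := by
    simp [hQ, eval_innerPoly, eval_outerPoly, hM.ne']
  have hHi : H = Lagrange.interpolate (Finset.range K) v fun k => H.eval (v k) := by
    refine Lagrange.eq_interpolate hinj ?_
    rw [Finset.card_range]
    exact lt_of_le_of_lt degree_le_natDegree (by exact_mod_cast hH)
  -- The barycentric form at 0, which is not a node since all nodes lie on the circle.
  have hL := Lagrange.eval_interpolate_not_at_node (s := Finset.range K) (v := v)
    (fun k => H.eval (v k)) (x := 0) (fun i _ => (circlePt_ne_zero _).symm)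
  rw [← hHi, ← hQn, hQ0] at hL
  rw [hL, Finset.mul_sum]
  refine Finset.sum_congr rfl fun k hk => ?_
  rw [Lagrange.nodalWeight_eq_eval_derivative_nodal hk, ← hQn]
  have hd := eval_derivative_blaschke (M := M) (h1 k) (h2 k) (hroot k (Finset.mem_range.1 hk))
  have hph : (phaseDeriv b M (t k) : ℂ)
      = M + ∑ i, (v k / (v k - b i) + b i * v k / (1 - b i * v k)) := by
    rw [phaseDeriv, Complex.ofReal_add, ← hr]
    simp only [hv, ← u_eq_logDeriv (hb _), Complex.ofReal_natCast]
  have hp0 : (phaseDeriv b M (t k) : ℂ) ≠ 0 := by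
    exact_mod_cast (phaseDeriv_pos hb hM (t k)).ne'
  rw [← hph, ← hQ] at hd
  have hv0 : v k ≠ 0 := circlePt_ne_zero _
  have hR : ∏ i, (1 - b i * v k) ≠ 0 := Finset.prod_ne_zero_iff.2 fun i _ => h2 k i
  have hQ' : (derivative Q).eval (v k) ≠ 0 := by
    intro h
    rw [h, mul_zero] at hd
    exact mul_ne_zero (mul_ne_zero hs hR) hp0 hd.symm
  rw [eval_outerPoly, zero_sub]
  change eval (v k) H / (∏ i, (1 - b i * v k)) / (phaseDeriv b M (t k) : ℂ) = _
  field_simp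
  linear_combination (eval (v k) H) * hd

end Circle

/-! ### From holomorphic functions to rational functions of the cosine -/

section Split

open Polynomial

variable {ι κ : Type*} [Fintype ι] [Fintype κ]

lemma outerPoly_sumElim (a : ι → ℂ) (a' : κ → ℂ) :
    outerPoly (Sum.elim a a') = outerPoly a * outerPoly a' := by
  simp [outerPoly, Fintype.prod_sum_type]

/-- The roots of the first factor lie outside the closed disc, those of the second inside. The
Bézout relations are (1 - a_i X) + a_i X = 1 and (1 - a_i X) + a_i (X - a_k) = 1 - a_i a_k ≠ 0. -/
lemma isCoprime_outerPoly {a : ι → ℂ} (ha : ∀ i, ‖a i‖ < 1) (j : ℕ) :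
    IsCoprime (outerPoly a) (X ^ j * innerPoly a) := by
  refine IsCoprime.prod_left fun i _ => IsCoprime.mul_right (IsCoprime.pow_right ?_)
    (IsCoprime.prod_right fun k _ => ?_)
  · exact ⟨1, C (a i), by ring⟩
  · have h : 1 - a i * a k ≠ 0 := one_sub_mul_ne_zero (ha i) (ha k).le
    refine ⟨C (1 - a i * a k)⁻¹, C (1 - a i * a k)⁻¹ * C (a i), ?_⟩
    have h1 : C (1 - a i * a k)⁻¹ * C (1 - a i * a k) = (1 : ℂ[X]) := by
      rw [← C_mul, inv_mul_cancel₀ h, C_1]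
    simp only [C_sub, C_1, C_mul] at h1
    linear_combination h1

/-- Splitting of a rational function on the circle into a part holomorphic inside and a part
holomorphic outside. -/
lemma exists_split {a : ι → ℂ} (ha : ∀ i, ‖a i‖ < 1) {T : ℕ} (hT : Fintype.card ι ≤ T)
    (P : ℂ[X]) (hP : P.natDegree ≤ 2 * T) :
    ∃ v w : ℂ[X], v.natDegree ≤ T ∧ w.natDegree ≤ T ∧ ∀ θ : ℝ,
      P.eval (circlePt θ) / circlePt θ ^ T
          / ((outerPoly a).eval (circlePt θ) * (outerPoly a).eval (circlePt (-θ)))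
        = v.eval (circlePt θ) / (outerPoly a).eval (circlePt θ)
          + w.eval (circlePt (-θ)) / (outerPoly a).eval (circlePt (-θ)) := by
  -- On the circle D(z) = z^T ∏ (1 - a_i/z), so the claim is a partial fraction decomposition over
  -- the coprime denominators D and `outerPoly a`.
  set D : ℂ[X] := X ^ (T - Fintype.card ι) * innerPoly a with hD
  have hDm : D.Monic := (monic_X_pow _).mul (monic_innerPoly a)
  have hDd : D.natDegree = T := by
    rw [(monic_X_pow _).natDegree_mul (monic_innerPoly a), natDegree_innerPoly, natDegree_X_pow]
    omega
  obtain ⟨x, y, hxy⟩ := isCoprime_outerPoly ha (T - Fintype.card ι)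
  rw [← hD] at hxy
  set r := (P * x) %ₘ D with hr
  have hrd : r.natDegree ≤ T := by
    rw [hr, ← hDd]; exact natDegree_modByMonic_le _ hDm
  set v := (P * x) /ₘ D * outerPoly a + P * y with hv
  have hPv : P = r * outerPoly a + D * v := by
    have h := modByMonic_add_div (P * x) D
    rw [hv]
    linear_combination (-P) * hxy - outerPoly a * h
  -- Reversing the coefficients of r turns r(z)/z^T into a polynomial in 1/z.
  refine ⟨v, reflect T r, ?_, ?_, fun θ => ?_⟩
  · by_cases hv0 : v = 0
    · simp [hv0]
    have h1 : (D * v).natDegree = T + v.natDegree := by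
      rw [hDm.natDegree_mul' hv0, hDd]
    have h2 : (D * v).natDegree ≤ 2 * T := by
      rw [show D * v = P - r * outerPoly a by rw [hPv]; ring]
      refine (natDegree_sub_le _ _).trans (max_le hP ?_)
      refine natDegree_mul_le.trans ?_
      have := natDegree_outerPoly_le a
      omega
    omega
  · exact (natDegree_reflect_le).trans (by simp [hrd])
  · set z := circlePt θ with hz
    have hz0 : z ≠ 0 := circlePt_ne_zero θ
    have e1 : D.eval z = z ^ T * (outerPoly a).eval (circlePt (-θ)) := by
      rw [hD, eval_mul, eval_pow, eval_X, eval_innerPoly, eval_outerPoly, circlePt_neg, ← hz]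
      have : ∀ i, z - a i = z * (1 - a i * z⁻¹) := fun i => by field_simp
      simp_rw [this]
      rw [Finset.prod_mul_distrib, Finset.prod_const, Finset.card_univ, ← mul_assoc, ← pow_add,
        Nat.sub_add_cancel hT]
    have e2 : (reflect T r).eval (circlePt (-θ)) * z ^ T = r.eval z := by
      let _ := invertibleOfNonzero hz0
      have := eval₂_reflect_mul_pow (RingHom.id ℂ) z T r hrd
      rwa [invOf_eq_inv, ← circlePt_neg] at this
    have h1 : (outerPoly a).eval z ≠ 0 := by
      rw [eval_outerPoly]
      exact Finset.prod_ne_zero_iff.2 fun i _ => one_sub_circlePt_ne (ha i) θ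
    have h2 : (outerPoly a).eval (circlePt (-θ)) ≠ 0 := by
      rw [eval_outerPoly]
      exact Finset.prod_ne_zero_iff.2 fun i _ => one_sub_circlePt_ne (ha i) (-θ)
    have hzT : z ^ T ≠ 0 := pow_ne_zero _ hz0
    conv_lhs => rw [hPv]
    rw [eval_add, eval_mul, eval_mul, e1, ← e2]
    field_simp
    ring

/-- A polynomial in `cos θ` as a Laurent polynomial in `e^{iθ}`. -/
lemma exists_eval_cos (q : ℂ[X]) {T : ℕ} (hq : q.natDegree ≤ T) :
    ∃ P : ℂ[X], P.natDegree ≤ 2 * T ∧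
      ∀ θ : ℝ, q.eval (Real.cos θ : ℂ) = P.eval (circlePt θ) / circlePt θ ^ T := by
  refine ⟨∑ k ∈ Finset.range (T + 1), C (q.coeff k / 2 ^ k) * (X ^ (T - k) * (X ^ 2 + 1) ^ k),
    ?_, fun θ => ?_⟩
  · refine natDegree_sum_le_of_forall_le _ _ fun k hk => ?_
    have hk' : k ≤ T := Nat.lt_succ_iff.1 (Finset.mem_range.1 hk)
    refine (natDegree_C_mul_le _ _).trans (natDegree_mul_le.trans ?_)
    have h1 : ((X ^ 2 + 1 : ℂ[X]) ^ k).natDegree ≤ k * 2 := natDegree_pow_le_of_le k (by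
      compute_degree)
    rw [natDegree_X_pow]
    omega
  · have hz0 := circlePt_ne_zero θ
    rw [eval_eq_sum_range' (Nat.lt_succ_of_le hq), eval_finsetSum, Finset.sum_div]
    refine Finset.sum_congr rfl fun k hk => ?_
    have hk' : k ≤ T := Nat.lt_succ_iff.1 (Finset.mem_range.1 hk)
    rw [cos_eq_circlePt]
    simp only [eval_mul, eval_C, eval_pow, eval_X, eval_add, eval_one]
    have h1 : circlePt θ ^ T = circlePt θ ^ (T - k) * circlePt θ ^ k := by
      rw [← pow_add, Nat.sub_add_cancel hk']
    have h2 : circlePt θ + (circlePt θ)⁻¹ = (circlePt θ ^ 2 + 1) / circlePt θ := by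
      field_simp
    rw [h1, h2, div_pow, div_pow]
    field_simp

lemma prod_denom_eq (a : ι → ℂ) (θ : ℝ) :
    ∏ i, (1 - 2 * a i * (Real.cos θ : ℂ) + a i ^ 2)
      = (outerPoly a).eval (circlePt θ) * (outerPoly a).eval (circlePt (-θ)) := by
  simp_rw [denom_eq, eval_outerPoly, ← Finset.prod_mul_distrib, circlePt_neg]

lemma integral_zero_pi_of_even {G : ℝ → ℂ} (hG : Continuous G) (he : ∀ θ, G (-θ) = G θ)
    (hp : ∀ θ, G (θ + 2 * Real.pi) = G θ) :
    2 * ∫ θ in (0 : ℝ)..Real.pi, G θ = ∫ θ in (0 : ℝ)..(2 * Real.pi), G θ := by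
  have hi := fun x y => hG.intervalIntegrable (μ := volume) x y
  rw [← intervalIntegral.integral_add_adjacent_intervals (hi 0 Real.pi) (hi _ (2 * Real.pi))]
  have h := intervalIntegral.integral_comp_sub_left (a := 0) (b := Real.pi) G (2 * Real.pi)
  have e : ∀ θ, G (2 * Real.pi - θ) = G θ := fun θ => by
    rw [sub_eq_add_neg, add_comm, hp, he]
  simp_rw [e] at h
  rw [show 2 * Real.pi - Real.pi = Real.pi by ring, sub_zero] at h
  rw [← h]; ring

lemma continuous_eval_div_outerPoly {a : ι → ℂ} (ha : ∀ i, ‖a i‖ < 1) (v : ℂ[X]) :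
    Continuous fun θ => v.eval (circlePt θ) / (outerPoly a).eval (circlePt θ) := by
  refine Continuous.div (v.continuous.comp continuous_circlePt)
    ((outerPoly a).continuous.comp continuous_circlePt) fun θ => ?_
  rw [eval_outerPoly]
  exact Finset.prod_ne_zero_iff.2 fun i _ => one_sub_circlePt_ne (ha i) θ

lemma integral_eval_div_outerPoly {a : ι → ℂ} (ha : ∀ i, ‖a i‖ < 1) (v : ℂ[X]) :
    ∫ θ in (0 : ℝ)..(2 * Real.pi), v.eval (circlePt θ) / (outerPoly a).eval (circlePt θ)
      = 2 * Real.pi * v.eval 0 := by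
  have hd : DifferentiableOn ℂ (fun z => v.eval z / (outerPoly a).eval z)
      (Metric.closedBall 0 1) := by
    intro z hz
    refine DifferentiableAt.differentiableWithinAt ?_
    refine DifferentiableAt.div v.differentiableAt (outerPoly a).differentiableAt ?_
    rw [eval_outerPoly]
    exact Finset.prod_ne_zero_iff.2 fun i _ => one_sub_mul_ne_zero (ha i) (by simpa using hz)
  rw [integral_zero_two_pi_of_holomorphic hd]
  simp [eval_outerPoly]

/-- The quadrature rule on the circle for rational functions of `cos θ` with prescribed poles. -/
theorem circle_quadrature {a : ι → ℂ} {a' : κ → ℂ} {M : ℕ} (ha : ∀ i, ‖a i‖ < 1)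
    (ha' : ∀ i, ‖a' i‖ < 1) (hM : 0 < M)
    (hr : ∀ θ, ∑ i, u (Sum.elim a a' i) θ = ((∑ i, (u (Sum.elim a a' i) θ).re : ℝ) : ℂ))
    {K : ℕ} (hK : K = M + (Fintype.card ι + Fintype.card κ))
    {s : ℂ} (hs : s⁻¹ = s) (hs0 : s ≠ 0) (t : ℕ → ℝ)
    (hinj : Set.InjOn (fun k => circlePt (t k)) (Finset.range K))
    (hexp : ∀ k < K, Complex.exp (Complex.I * phase (Sum.elim a a') M (t k)) = s)
    (q : ℂ[X]) (hq : q.natDegree + Fintype.card κ < K) :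
    1 / Real.pi * ∫ θ in (0 : ℝ)..Real.pi,
        q.eval (Real.cos θ : ℂ) / ∏ i, (1 - 2 * a i * (Real.cos θ : ℂ) + a i ^ 2)
      = ∑ k ∈ Finset.range K,
        q.eval (Real.cos (t k) : ℂ) / (∏ i, (1 - 2 * a i * (Real.cos (t k) : ℂ) + a i ^ 2))
          / (phaseDeriv (Sum.elim a a') M (t k) : ℂ) := by
  obtain ⟨T, hT1, hT2, hT3⟩ : ∃ T, q.natDegree ≤ T ∧ Fintype.card ι ≤ T ∧
      T + Fintype.card κ < K := by
    -- The splitting needs T to be at least the number of poles; that this choice of T remains small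
    -- enough uses M > 0.
    refine ⟨max q.natDegree (Fintype.card ι), le_max_left _ _, le_max_right _ _, ?_⟩
    rcases max_choice q.natDegree (Fintype.card ι) with h | h <;> rw [h] <;> omega
  obtain ⟨P, hP, hPq⟩ := exists_eval_cos q hT1
  obtain ⟨v, w, hv, hw, hsplit⟩ := exists_split ha hT2 P hP
  set G : ℝ → ℂ := fun θ => q.eval (Real.cos θ : ℂ)
    / ∏ i, (1 - 2 * a i * (Real.cos θ : ℂ) + a i ^ 2) with hG
  have hGs : ∀ θ, G θ = v.eval (circlePt θ) / (outerPoly a).eval (circlePt θ)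
      + w.eval (circlePt (-θ)) / (outerPoly a).eval (circlePt (-θ)) := by
    intro θ
    rw [← hsplit, ← hPq, ← prod_denom_eq]
  have hGc : Continuous G := by
    refine Continuous.div (q.continuous.comp (by fun_prop)) (by fun_prop) fun θ => ?_
    exact Finset.prod_ne_zero_iff.2 fun i _ => denom_ne_zero (ha i) θ
  have hint : ∫ θ in (0 : ℝ)..Real.pi, G θ = Real.pi * (v.eval 0 + w.eval 0) := by
    have h := integral_zero_pi_of_even hGc (fun θ => by simp [hG])
      (fun θ => by simp only [hG, Real.cos_add_two_pi])
    have hcv := continuous_eval_div_outerPoly ha v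
    have hcw := continuous_eval_div_outerPoly ha w
    have hcw' : Continuous fun θ =>
        w.eval (circlePt (-θ)) / (outerPoly a).eval (circlePt (-θ)) := hcw.comp continuous_neg
    simp_rw [hGs] at h ⊢
    rw [intervalIntegral.integral_add (a := 0) (b := 2 * Real.pi) (hcv.intervalIntegrable _ _)
      (hcw'.intervalIntegrable _ _), integral_zero_two_pi_comp_neg
      (fun θ => w.eval (circlePt θ) / (outerPoly a).eval (circlePt θ))
      (fun θ => by simp only [circlePt_add_two_pi]),
      integral_eval_div_outerPoly ha, integral_eval_div_outerPoly ha] at h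
    linear_combination h / 2
  have hpi : (Real.pi : ℂ) ≠ 0 := by simp [Real.pi_ne_zero]
  rw [hint, one_div, inv_mul_cancel_left₀ hpi]
  have hb : ∀ i, ‖Sum.elim a a' i‖ < 1 := by rintro (i | i) <;> simp [ha, ha']
  -- The nodes are quantified anew so that the rule also applies to the reflected ones. Multiplying
  -- by `outerPoly a'` cancels the poles that the integrand does not have.
  have key : ∀ (t : ℕ → ℝ), Set.InjOn (fun k => circlePt (t k)) (Finset.range K) →
      (∀ k < K, Complex.exp (Complex.I * phase (Sum.elim a a') M (t k)) = s) →
      ∀ v : ℂ[X], v.natDegree ≤ T →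
      ∑ k ∈ Finset.range K, v.eval (circlePt (t k)) / (outerPoly a).eval (circlePt (t k))
        / (phaseDeriv (Sum.elim a a') M (t k) : ℂ) = v.eval 0 := by
    intro t hinj hexp v hv
    have hc : K = M + Fintype.card (ι ⊕ κ) := by rw [hK, Fintype.card_sum]
    rw [hc] at hinj hexp
    have hdeg : (v * outerPoly a').natDegree < M + Fintype.card (ι ⊕ κ) := by
      rw [← hc]
      refine lt_of_le_of_lt (natDegree_mul_le.trans ?_) hT3
      exact add_le_add hv (natDegree_outerPoly_le a')
    have h := sum_eval_div_phaseDeriv hb hM hr hs0 t hinj hexp _ hdeg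
    rw [← hc] at h
    have h0 : (v * outerPoly a').eval 0 = v.eval 0 := by simp [eval_outerPoly]
    rw [h0] at h
    rw [← h]
    refine Finset.sum_congr rfl fun k _ => ?_
    have h1 : (outerPoly a').eval (circlePt (t k)) ≠ 0 := by
      rw [eval_outerPoly]
      exact Finset.prod_ne_zero_iff.2 fun i _ => one_sub_circlePt_ne (ha' i) _
    rw [outerPoly_sumElim, eval_mul, eval_mul, mul_div_mul_right _ _ h1]
  have k1 := key t hinj hexp v hv
  -- Reflection inverts the value of the Blaschke product, and s is its own inverse.
  have k2 := key (fun k => -t k)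
    (fun x hx y hy hxy => hinj hx hy (by simpa [circlePt_neg] using hxy))
    (fun k hk => by
      rw [phase_neg, Complex.ofReal_neg, mul_neg, Complex.exp_neg, hexp k hk, hs]) w hw
  simp_rw [phaseDeriv_neg] at k2
  rw [← k1, ← k2, ← Finset.sum_add_distrib]
  refine Finset.sum_congr rfl fun k _ => ?_
  rw [← add_div, ← hGs]

end Split

/-! ### Folding the circle onto the interval -/

/-- A sum over a full period of nodes, folded by the reflection symmetry. -/
lemma sum_range_fold {K N σ τ : ℕ} (hN : 0 < N) (hK0 : 0 < K) (hK : K + 2 = 2 * N + σ + τ)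
    (hσ : σ ≤ 2) (hτ : τ ≤ 2) (F : ℤ → ℂ) (hF : ∀ l : ℤ, F (K - σ - l) = F l)
    (h0 : σ = 2 → F (-1) = 0) (h1 : τ = 2 → F N = 0) :
    ∑ k ∈ Finset.range K, F k
      = 2 * ∑ l ∈ Finset.range N, (1 / 2 : ℂ) ^ ((if σ = 0 then 1 else 0) * (if l = 0 then 1 else 0)
        + (if τ = 0 then 1 else 0) * (if l + 1 = N then 1 else 0)) * F l := by
  -- The labels N, …, K - 1 reflect to 1 - σ, …, N - 2 + τ. Compared with 0, …, N - 1 this range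
  -- lacks 0 if σ = 0 and N - 1 if τ = 0, whence the half weights; it gains -1 if σ = 2 and N if τ =
  -- 2, where F vanishes.
  have hA : ∑ j ∈ Finset.range (N - 1 + τ), F j
      = ∑ j ∈ Finset.range N, F j - (if τ = 0 then 1 else 0) * F (N - 1) := by
    obtain ⟨n, rfl⟩ : ∃ n, N = n + 1 := ⟨N - 1, by omega⟩
    interval_cases τ
    · simp [Finset.sum_range_succ]
    · simp
    · have h := h1 rfl
      simp only [Nat.add_sub_cancel, Finset.sum_range_succ _ (n + 1), h]
      simp
  have hB : ∑ j ∈ Finset.range (K - N), F (j + 1 - σ)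
      = ∑ j ∈ Finset.range (N - 1 + τ), F j - (if σ = 0 then 1 else 0) * F 0 := by
    interval_cases σ
    · have : N - 1 + τ = (K - N) + 1 := by omega
      rw [this, Finset.sum_range_succ']
      simp
    · have : N - 1 + τ = K - N := by omega
      rw [this]
      simp
    · have : K - N = (N - 1 + τ) + 1 := by omega
      rw [this, Finset.sum_range_succ']
      have e : ∀ j : ℕ, ((j + 1 : ℕ) : ℤ) + 1 - (2 : ℕ) = j := fun j => by push_cast; ring
      simp only [e]
      simpa using h0 rfl
  have hC : ∑ j ∈ Finset.range (K - N), F (N + j : ℕ)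
      = ∑ j ∈ Finset.range (K - N), F (j + 1 - σ) := by
    rw [← Finset.sum_range_reflect]
    refine Finset.sum_congr rfl fun j hj => ?_
    rw [Finset.mem_range] at hj
    rw [← hF]
    congr 1
    omega
  have hS : ∑ k ∈ Finset.range K, F k
      = ∑ j ∈ Finset.range N, F j + ∑ j ∈ Finset.range (K - N), F (N + j : ℕ) := by
    rw [← Finset.sum_range_add, Nat.add_sub_cancel' (by omega)]
  have hW : ∀ l ∈ Finset.range N, (1 / 2 : ℂ) ^ ((if σ = 0 then 1 else 0) * (if l = 0 then 1 else 0)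
        + (if τ = 0 then 1 else 0) * (if l + 1 = N then 1 else 0)) * F l
      = F l - (if l = 0 then (if σ = 0 then 1 else 0) * F 0 / 2 else 0)
        - (if l = N - 1 then (if τ = 0 then 1 else 0) * F (N - 1) / 2 else 0) := by
    intro l hl
    have e : l + 1 = N ↔ l = N - 1 := by omega
    -- Since K > 0, a single label is never halved at both ends.
    have hb : ¬ (σ = 0 ∧ τ = 0 ∧ N = 1) := by omega
    have hc : ((N - 1 : ℕ) : ℤ) = (N : ℤ) - 1 := by omega
    simp only [e, ← hc]
    clear hF h0 h1 hA hB hC hS hc e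
    by_cases h2 : l = 0
    · subst h2
      by_cases h3 : 0 = N - 1
      · rw [← h3]
        by_cases h4 : σ = 0
        · have h5 : τ ≠ 0 := fun h5 => hb ⟨h4, h5, by omega⟩
          simp [h4, h5]; ring
        · by_cases h5 : τ = 0 <;> simp [h4, h5]; ring
      · by_cases h4 : σ = 0 <;> simp [h4, h3]; ring
    · by_cases h3 : l = N - 1
      · rw [← h3]
        by_cases h5 : τ = 0 <;> simp [h2, h5]; ring
      · simp [h2, h3]
  rw [hS, hC, hB, hA, Finset.sum_congr rfl hW, Finset.sum_sub_distrib, Finset.sum_sub_distrib,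
    Finset.sum_ite_eq', Finset.sum_ite_eq', if_pos (Finset.mem_range.2 hN),
    if_pos (Finset.mem_range.2 (by omega))]
  ring

/-! ### The one-variable rule -/

section Nodes

variable {d d' : ℕ} {a : Fin d → ℂ} {a' : Fin d' → ℂ} {εp εm ηp ηm N M : ℕ}

lemma norm_sumElim_lt {ι κ : Type*} {a : ι → ℂ} {a' : κ → ℂ} (ha : ∀ r, ‖a r‖ < 1)
    (ha' : ∀ r, ‖a' r‖ < 1) (i : ι ⊕ κ) : ‖Sum.elim a a' i‖ < 1 := by
  rcases i with i | i <;> simp [ha, ha']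

lemma sum_u_sumElim_eq_ofReal (hc : ConjInvariant a) (hc' : ConjInvariant a') (θ : ℝ) :
    ∑ i, u (Sum.elim a a' i) θ = ((∑ i, (u (Sum.elim a a' i) θ).re : ℝ) : ℂ) := by
  simp only [Fintype.sum_sum_type, Sum.elim_inl, Sum.elim_inr, Complex.ofReal_add,
    sum_u_eq_ofReal hc, sum_u_eq_ofReal hc']

lemma two_mul_sub_halfDefect (hM : M + d + d' + 2 = 2 * N + εp + εm + ηp + ηm) :
    2 * ((N : ℝ) - 1 - halfDefect d εp εm - halfDefect d' ηp ηm) = M := by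
  have : (M : ℝ) + d + d' + 2 = 2 * N + εp + εm + ηp + ηm := by exact_mod_cast hM
  unfold halfDefect
  linarith

lemma nodeEq_iff (ha : ∀ r, ‖a r‖ < 1) (ha' : ∀ r, ‖a' r‖ < 1) (hc : ConjInvariant a)
    (hc' : ConjInvariant a') (hM : M + d + d' + 2 = 2 * N + εp + εm + ηp + ηm) (l : ℕ) (x : ℝ) :
    NodeEq a a' εp εm ηp ηm N l x ↔
      phase (Sum.elim a a') M x = Real.pi * (2 * (l : ℝ) + (εm + ηm : ℕ)) := by
  have h := ofReal_phase (M := M) (norm_sumElim_lt ha ha') (sum_u_sumElim_eq_ofReal hc hc') x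
  rw [NodeEq, two_mul_sub_halfDefect hM, ← Complex.ofReal_inj, h, Fintype.sum_sum_type]
  simp only [Sum.elim_inl, Sum.elim_inr]
  push_cast
  rw [add_assoc, add_assoc]

lemma weight_eq (hc : ConjInvariant a) (hc' : ConjInvariant a')
    (hM : M + d + d' + 2 = 2 * N + εp + εm + ηp + ηm)
    (hεp : εp ≤ 1) (hεm : εm ≤ 1) (hηp : ηp ≤ 1) (hηm : ηm ≤ 1) (l : ℕ) (x : ℝ) :
    weight a a' εp εm ηp ηm N l x
      = (1 / 2 : ℂ) ^ ((if εm + ηm = 0 then 1 else 0) * (if l = 0 then 1 else 0)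
        + (if εp + ηp = 0 then 1 else 0) * (if l + 1 = N then 1 else 0))
        * (phaseDeriv (Sum.elim a a') M x : ℂ)⁻¹ := by
  have e : ∀ {x y : ℕ}, x ≤ 1 → y ≤ 1 → (1 - x) * (1 - y) = if x + y = 0 then 1 else 0 := by
    intro x y hx hy
    interval_cases x <;> interval_cases y <;> rfl
  rw [weight, two_mul_sub_halfDefect hM, e hεm hηm, e hεp hηp, phaseDeriv, Complex.ofReal_add,
    ← sum_u_sumElim_eq_ofReal hc hc', Fintype.sum_sum_type, ← add_assoc]
  simp only [Sum.elim_inl, Sum.elim_inr, Complex.ofReal_natCast]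

/-- The one-variable weight function. -/
def singleDensity (a : Fin d → ℂ) (εp εm : ℕ) (θ : ℝ) : ℂ :=
  ((2 ^ (εp + εm) * (1 + εp * Real.cos θ) * (1 - εm * Real.cos θ) : ℝ) : ℂ)
    / ∏ r, (1 - 2 * a r * (Real.cos θ : ℂ) + a r ^ 2)

open Polynomial in
/-- The one-variable quadrature rule. -/
theorem interval_quadrature (ha : ∀ r, ‖a r‖ < 1) (ha' : ∀ r, ‖a' r‖ < 1)
    (hc : ConjInvariant a) (hc' : ConjInvariant a')
    (hM : M + d + d' + 2 = 2 * N + εp + εm + ηp + ηm) (hM0 : 0 < M) (hN : 0 < N)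
    (hεp : εp ≤ 1) (hεm : εm ≤ 1) (hηp : ηp ≤ 1) (hηm : ηm ≤ 1)
    (t : ℤ → ℝ)
    (ht : ∀ l, phase (Sum.elim a a') M (t l) = Real.pi * (2 * (l : ℝ) + (εm + ηm : ℕ)))
    (p : ℂ[X]) (hp : p.natDegree + d' + 3 ≤ 2 * N + ηp + ηm) :
    1 / (2 * Real.pi) * ∫ θ in (0 : ℝ)..Real.pi,
        p.eval (Real.cos θ : ℂ) * singleDensity a εp εm θ
      = ∑ l ∈ Finset.range N, p.eval (Real.cos (t l) : ℂ) * singleDensity a εp εm (t l)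
        * weight a a' εp εm ηp ηm N l (t l) := by
  have hb := norm_sumElim_lt ha ha'
  have hr := sum_u_sumElim_eq_ofReal hc hc'
  set σ := εm + ηm with hσ
  set K := M + (d + d') with hK
  have hcard : (M + Fintype.card (Fin d ⊕ Fin d') : ℕ) = K := by simp [hK]
  have hinjφ : Function.Injective (phase (Sum.elim a a') M) := (strictMono_phase hb hM0).injective
  have hpi := Real.pi_pos
  set s : ℂ := Complex.exp (Complex.I * (Real.pi * σ : ℝ)) with hs
  have hs1 : s⁻¹ = s := by
    rw [hs, ← Complex.exp_neg, Complex.exp_eq_exp_iff_exists_int]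
    refine ⟨-σ, ?_⟩
    push_cast
    ring
  have hexp : ∀ k < K, Complex.exp (Complex.I * phase (Sum.elim a a') M (t (k : ℕ))) = s := by
    intro k _
    rw [ht, hs, Complex.exp_eq_exp_iff_exists_int]
    refine ⟨k, ?_⟩
    push_cast
    ring
  -- If two nodes agree up to j full turns, their phases differ by 2πjK, so their labels differ by
  -- jK; labels below K force j = 0.
  have hinj : Set.InjOn (fun k : ℕ => circlePt (t k)) (Finset.range K) := by
    intro k hk k' hk' h
    simp only [circlePt, Complex.exp_eq_exp_iff_exists_int] at h
    obtain ⟨j, hj⟩ := h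
    have h1 : t k = t k' + j * (2 * Real.pi) := by
      have : ((t k : ℝ) : ℂ) * Complex.I = ((t k' + j * (2 * Real.pi) : ℝ) : ℂ) * Complex.I := by
        rw [hj]; push_cast; ring
      exact_mod_cast mul_right_cancel₀ Complex.I_ne_zero this
    have h2 := phase_add_int_mul_two_pi (M := M) hb (t k') j
    rw [← h1, ht, ht, hcard] at h2
    have h3 : (k : ℝ) = k' + j * K := by
      have : 2 * Real.pi * ((k : ℝ) - (k' + j * K)) = 0 := by
        push_cast at h2 ⊢; linarith
      rcases mul_eq_zero.1 this with h | h
      · linarith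
      · linarith
    have h4 : (k : ℤ) = k' + j * K := by exact_mod_cast h3
    have hk1 : k < K := by simpa using hk
    have hk2 : k' < K := by simpa using hk'
    have : j = 0 := by
      by_contra hj0
      rcases lt_or_gt_of_ne hj0 with h | h <;> nlinarith
    rw [this] at h4
    omega
  set q : ℂ[X] := p * (C (2 ^ (εp + εm)) * (1 + C (εp : ℂ) * X) * (1 - C (εm : ℂ) * X)) with hq
  have hqd : q.natDegree ≤ p.natDegree + (εp + εm) := by
    refine natDegree_mul_le.trans (Nat.add_le_add_left ?_ _)
    refine natDegree_mul_le.trans (Nat.add_le_add ?_ ?_)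
    · refine (natDegree_C_mul_le _ _).trans ?_
      interval_cases εp
      · simp
      · compute_degree
    · interval_cases εm
      · simp
      · compute_degree
  have hqe : ∀ θ : ℝ, q.eval (Real.cos θ : ℂ)
        / ∏ r, (1 - 2 * a r * (Real.cos θ : ℂ) + a r ^ 2)
      = p.eval (Real.cos θ : ℂ) * singleDensity a εp εm θ := by
    intro θ
    rw [singleDensity, hq, eval_mul, mul_div_assoc]
    simp
  have h := circle_quadrature ha ha' hM0 hr (K := K) (by simp [hK]) hs1 (Complex.exp_ne_zero _)
    (fun k => t k) hinj hexp q (by rw [Fintype.card_fin]; omega)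
  set F : ℤ → ℂ := fun l => q.eval (Real.cos (t l) : ℂ)
        / (∏ r, (1 - 2 * a r * (Real.cos (t l) : ℂ) + a r ^ 2))
          / (phaseDeriv (Sum.elim a a') M (t l) : ℂ) with hF
  -- The label K - σ - l belongs to the node 2π - t l, and F depends on the node through even
  -- 2π-periodic functions.
  have hrefl : ∀ l : ℤ, F (K - σ - l) = F l := by
    intro l
    have e : t (K - σ - l) = -t l + 2 * Real.pi := by
      refine hinjφ ?_
      rw [phase_add_two_pi hb, phase_neg, ht, ht, hcard]
      push_cast
      ring
    simp only [hF, e, Real.cos_add_two_pi, Real.cos_neg, phaseDeriv_add_two_pi, phaseDeriv_neg]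
  -- Here the label -1 sits at angle 0, where the factor 1 - cos θ of the density vanishes; likewise
  -- the label N sits at π below, with the factor 1 + cos θ.
  have hF0 : σ = 2 → F (-1) = 0 := by
    intro h2
    have e : t (-1) = 0 := by
      refine hinjφ ?_
      rw [ht, phase_zero, h2]
      norm_num
    have : εm = 1 := by omega
    simp [hF, e, hq, this]
  have hF1 : εp + ηp = 2 → F N = 0 := by
    intro h2
    have e : t N = Real.pi := by
      refine hinjφ ?_
      rw [ht, phase_pi hb, hcard]
      have : K = 2 * N + σ := by omega
      rw [this]
      push_cast
      ring
    have : εp = 1 := by omega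
    simp [hF, e, hq, this]
  have hfold := sum_range_fold (σ := σ) (τ := εp + ηp) hN (by omega) (by omega) (by omega)
    (by omega) F hrefl hF0 hF1
  simp_rw [hqe] at h
  have hsum : ∑ k ∈ Finset.range K, p.eval (Real.cos (t k) : ℂ) * singleDensity a εp εm (t k)
        / (phaseDeriv (Sum.elim a a') M (t k) : ℂ) = ∑ k ∈ Finset.range K, F k := by
    simp only [hF, hqe]
  rw [hsum, hfold] at h
  have e1 : (1 : ℂ) / (2 * Real.pi) = 1 / 2 * (1 / Real.pi) := by
    rw [one_div_mul_one_div]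
  rw [e1, mul_assoc, h, ← mul_assoc, one_div, inv_mul_cancel₀ two_ne_zero, one_mul]
  refine Finset.sum_congr rfl fun l _ => ?_
  rw [weight_eq hc hc' hM hεp hεm hηp hηm]
  simp only [hF, hqe]
  ring

end Nodes

/-! ### Product rules and the squared Vandermonde -/

section Product

lemma continuous_singleDensity {d : ℕ} {a : Fin d → ℂ} (ha : ∀ r, ‖a r‖ < 1) (εp εm : ℕ) :
    Continuous (singleDensity a εp εm) := by
  unfold singleDensity
  refine Continuous.div (by fun_prop) (by fun_prop) fun θ => ?_
  exact Finset.prod_ne_zero_iff.2 fun r _ => denom_ne_zero (ha r) θ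

/-- The product of `n` copies of a quadrature rule. -/
lemma product_quadrature {n N D : ℕ} {W : ℝ → ℂ} (hW : Continuous W) {c : ℂ} {t : ℕ → ℝ}
    {w : ℕ → ℂ}
    (hq : ∀ k ≤ D, c * ∫ θ in (0 : ℝ)..Real.pi, (Real.cos θ : ℂ) ^ k * W θ
      = ∑ l ∈ Finset.range N, (Real.cos (t l) : ℂ) ^ k * W (t l) * w l)
    (F : MvPolynomial (Fin n) ℂ) (hF : ∀ j, F.degreeOf j ≤ D) :
    c ^ n * ∫ θ in Set.univ.pi (fun _ : Fin n => Set.Icc (0 : ℝ) Real.pi),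
        MvPolynomial.eval (fun j => (Real.cos (θ j) : ℂ)) F * ∏ j, W (θ j)
      = ∑ k ∈ Fintype.piFinset fun _ : Fin n => Finset.range N,
        MvPolynomial.eval (fun j => (Real.cos (t (k j)) : ℂ)) F * ∏ j, W (t (k j)) * w (k j) := by
  have hmono : ∀ (α : Fin n →₀ ℕ) (θ : Fin n → ℝ),
      MvPolynomial.coeff α F * (∏ j, (Real.cos (θ j) : ℂ) ^ α j) * ∏ j, W (θ j)
        = MvPolynomial.coeff α F * ∏ j, (Real.cos (θ j) : ℂ) ^ α j * W (θ j) := by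
    intro α θ
    rw [Finset.prod_mul_distrib, mul_assoc]
  simp_rw [MvPolynomial.eval_eq', Finset.sum_mul, hmono]
  rw [integral_finsetSum]
  · rw [Finset.mul_sum, Finset.sum_comm]
    refine Finset.sum_congr rfl fun α hα => ?_
    rw [integral_const_mul]
    have h1 : ∫ θ in Set.univ.pi (fun _ : Fin n => Set.Icc (0 : ℝ) Real.pi),
        ∏ j, (Real.cos (θ j) : ℂ) ^ α j * W (θ j)
        = ∏ j, ∫ θ in (0 : ℝ)..Real.pi, (Real.cos θ : ℂ) ^ α j * W θ := by
      rw [volume_pi, Measure.restrict_pi_pi,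
        integral_fintype_prod_eq_prod (𝕜 := ℂ) (E := fun _ : Fin n => ℝ)
          (fun j x => (Real.cos x : ℂ) ^ α j * W x)]
      refine Finset.prod_congr rfl fun j _ => ?_
      rw [integral_Icc_eq_integral_Ioc, intervalIntegral.integral_of_le Real.pi_pos.le]
    have h2 : c ^ n = ∏ _j : Fin n, c := by simp
    rw [h1, mul_left_comm, h2, ← Finset.prod_mul_distrib,
      Finset.prod_congr rfl fun j _ => hq (α j)
        ((MvPolynomial.monomial_le_degreeOf j hα).trans (hF j)),
      Finset.prod_univ_sum, Finset.mul_sum]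
    refine Finset.sum_congr rfl fun k _ => ?_
    rw [mul_assoc, ← Finset.prod_mul_distrib]
    simp only [mul_assoc]
  · intro α _
    refine ContinuousOn.integrableOn_compact (isCompact_univ_pi fun _ => isCompact_Icc) ?_
    fun_prop

/-- The square of the Vandermonde product. -/
def vandermondeSq (n : ℕ) : MvPolynomial (Fin n) ℂ :=
  ∏ j, ∏ k ∈ Finset.Ioi j, (MvPolynomial.X j - MvPolynomial.X k) ^ 2

lemma eval_vandermondeSq {n : ℕ} (y : Fin n → ℂ) :
    MvPolynomial.eval y (vandermondeSq n) = (Matrix.vandermonde y).det ^ 2 := by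
  rw [Matrix.det_vandermonde, vandermondeSq, ← Finset.prod_pow]
  simp only [map_prod, map_pow, map_sub, MvPolynomial.eval_X, ← Finset.prod_pow]
  exact Finset.prod_congr rfl fun j _ => Finset.prod_congr rfl fun k _ => by ring

lemma eval_vandermondeSq_comp_perm {n : ℕ} (y : Fin n → ℂ) (σ : Equiv.Perm (Fin n)) :
    MvPolynomial.eval (y ∘ σ) (vandermondeSq n) = MvPolynomial.eval y (vandermondeSq n) := by
  have h : Matrix.vandermonde (y ∘ σ) = (Matrix.vandermonde y).submatrix σ id := by
    ext i j; simp [Matrix.vandermonde_apply]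
  have hs : (((Equiv.Perm.sign σ : ℤˣ) : ℤ) : ℂ) ^ 2 = 1 := by
    rw [← Int.cast_pow, ← Units.val_pow_eq_pow_val, Int.units_sq]
    simp
  rw [eval_vandermondeSq, eval_vandermondeSq, h, Matrix.det_permute, mul_pow, hs, one_mul]

lemma eval_vandermondeSq_eq_zero {n : ℕ} {y : Fin n → ℂ} (hy : ¬ Function.Injective y) :
    MvPolynomial.eval y (vandermondeSq n) = 0 := by
  rw [eval_vandermondeSq]
  have : (Matrix.vandermonde y).det = 0 := by
    by_contra h
    exact hy (Matrix.det_vandermonde_ne_zero_iff.1 h)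
  simp [this]

/-- The variable i occurs in n - 1 - i factors as first index and in i factors as second index, each
squared. -/
lemma degreeOf_vandermondeSq_le {n : ℕ} (i : Fin n) :
    (vandermondeSq n).degreeOf i ≤ 2 * (n - 1) := by
  have h1 : ∀ j k : Fin n,
      ((MvPolynomial.X j - MvPolynomial.X k : MvPolynomial (Fin n) ℂ) ^ 2).degreeOf i
        ≤ (if j = i then 2 else 0) + (if k = i then 2 else 0) := by
    intro j k
    refine (MvPolynomial.degreeOf_pow_le _ _ _).trans ?_
    have h := MvPolynomial.degreeOf_sub_le i (MvPolynomial.X j : MvPolynomial (Fin n) ℂ)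
      (MvPolynomial.X k)
    simp only [MvPolynomial.degreeOf_X] at h
    have e1 : (if i = j then 1 else 0 : ℕ) = if j = i then 1 else 0 := by simp [eq_comm]
    have e2 : (if i = k then 1 else 0 : ℕ) = if k = i then 1 else 0 := by simp [eq_comm]
    rw [e1, e2] at h
    split_ifs at h ⊢ <;> simp at h <;> omega
  have h2 : (vandermondeSq n).degreeOf i
      ≤ ∑ j, ∑ k ∈ Finset.Ioi j, ((if j = i then 2 else 0) + (if k = i then 2 else 0)) :=
    (MvPolynomial.degreeOf_prod_le _ _ _).trans (Finset.sum_le_sum fun j _ =>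
      (MvPolynomial.degreeOf_prod_le _ _ _).trans (Finset.sum_le_sum fun k _ => h1 j k))
  refine h2.trans ?_
  have h3 : ∑ j : Fin n, ∑ k ∈ Finset.Ioi j, (if k = i then 2 else 0)
      = ∑ j : Fin n, if j < i then 2 else 0 :=
    Finset.sum_congr rfl fun j _ => by simp [Finset.sum_ite_eq']
  have h4 : ∑ j : Fin n, ∑ k ∈ Finset.Ioi j, (if j = i then 2 else 0) = 2 * (n - 1 - i) := by
    simp only [Finset.sum_const, Fin.card_Ioi, smul_eq_mul, mul_ite, mul_zero]
    simp [mul_comm]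
  have h5 : ∑ j : Fin n, (if j < i then 2 else 0) = 2 * (i : ℕ) := by
    rw [← Finset.sum_filter]
    have : (Finset.univ.filter fun j => j < i) = Finset.Iio i := by ext; simp
    simp [this, mul_comm]
  simp_rw [Finset.sum_add_distrib]
  rw [h3, h4, h5]
  have := i.isLt
  omega

end Product

/-! ### From label tuples to partitions -/

section Partitions

/-- Every injective tuple is a unique rearrangement of a strictly decreasing one. -/
lemma sum_piFinset_eq_factorial_mul {n N : ℕ} (Φ : (Fin n → ℕ) → ℂ)
    (hs : ∀ k (σ : Equiv.Perm (Fin n)), Φ (k ∘ σ) = Φ k)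
    (h0 : ∀ k, ¬ Function.Injective k → Φ k = 0) [DecidablePred (@StrictAnti (Fin n) ℕ _ _)] :
    ∑ k ∈ Fintype.piFinset fun _ : Fin n => Finset.range N, Φ k
      = n.factorial * ∑ k ∈ (Fintype.piFinset fun _ : Fin n => Finset.range N).filter
          (fun k => StrictAnti k), Φ k := by
  classical
  set S := Fintype.piFinset fun _ : Fin n => Finset.range N with hS
  have hcomp : ∀ k ∈ S, ∀ g : Fin n → Fin n, k ∘ g ∈ S := by
    intro k hk g
    rw [hS, Fintype.mem_piFinset] at hk ⊢
    exact fun j => hk (g j)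
  have e1 : ∑ k ∈ S, Φ k = ∑ k ∈ S.filter (fun k => Function.Injective k), Φ k := by
    rw [Finset.sum_filter]
    refine Finset.sum_congr rfl fun k _ => ?_
    split_ifs with h
    · rfl
    · exact h0 k h
  have e2 : (n.factorial : ℂ) * ∑ k ∈ S.filter (fun k => StrictAnti k), Φ k
      = ∑ x ∈ (Finset.univ : Finset (Equiv.Perm (Fin n))) ×ˢ S.filter (fun k => StrictAnti k),
        Φ x.2 := by
    rw [Finset.sum_product]
    simp [Fintype.card_perm]
  rw [e1, e2]
  symm
  refine Finset.sum_bij (fun x _ => x.2 ∘ x.1) ?_ ?_ ?_ ?_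
  · rintro ⟨σ, k⟩ hx
    simp only [Finset.mem_product, Finset.mem_univ, true_and, Finset.mem_filter] at hx ⊢
    exact ⟨hcomp k hx.1 σ, hx.2.injective.comp σ.injective⟩
  · rintro ⟨σ, k⟩ hx ⟨σ', k'⟩ hx' h
    simp only [Finset.mem_product, Finset.mem_univ, true_and, Finset.mem_filter] at hx hx' h
    have hk : k = k' := by
      -- A monotone enumeration is determined by its range; reversal makes the decreasing tuples
      -- increasing.
      have hr : Set.range (k ∘ Fin.rev) = Set.range (k' ∘ Fin.rev) := by
        rw [Fin.rev_surjective.range_comp, Fin.rev_surjective.range_comp,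
          ← σ.surjective.range_comp k, ← σ'.surjective.range_comp k', h]
      have hm := (StrictMono.range_inj (hx.2.comp Fin.rev_strictAnti)
        (hx'.2.comp Fin.rev_strictAnti)).1 hr
      exact Fin.rev_surjective.injective_comp_right hm
    subst hk
    have hσ : σ = σ' := Equiv.ext fun i => hx.2.injective (congrFun h i)
    rw [hσ]
  · intro k hk
    rw [Finset.mem_filter] at hk
    set τ := Tuple.sort k with hτ
    have hm : StrictMono (k ∘ τ) :=
      (Tuple.monotone_sort k).strictMono_of_injective (hk.2.comp τ.injective)
    -- `Tuple.sort` sorts increasingly, so the sorted tuple is reversed and the permutation undoes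
    -- both operations.
    refine ⟨(τ⁻¹.trans Fin.revPerm, (k ∘ τ) ∘ Fin.rev), ?_, ?_⟩
    · simp only [Finset.mem_product, Finset.mem_univ, true_and, Finset.mem_filter]
      exact ⟨hcomp _ (hcomp _ hk.1 _) _, hm.comp_strictAnti Fin.rev_strictAnti⟩
    · ext i
      simp
  · rintro ⟨σ, k⟩ _
    exact (hs k σ).symm

lemma antitone_add_val_of_strictAnti {n : ℕ} {k : Fin n → ℕ} (hk : StrictAnti k) :
    Antitone fun j : Fin n => k j + j := by
  rcases n with _ | n
  · exact fun i => i.elim0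
  · refine Fin.antitone_iff_succ_le.2 fun i => ?_
    have := hk (Fin.castSucc_lt_succ (i := i))
    simp only [Fin.val_succ, Fin.val_castSucc]
    omega

lemma sum_partitions_shifted {m n : ℕ} (hn : 1 ≤ n) (Φ : (Fin n → ℕ) → ℂ)
    [DecidablePred (@StrictAnti (Fin n) ℕ _ _)] :
    ∑ lam ∈ partitions m n, Φ (shifted lam)
      = ∑ k ∈ (Fintype.piFinset fun _ : Fin n => Finset.range (m + n)).filter
          (fun k => StrictAnti k), Φ k := by
  refine Finset.sum_bij (fun lam _ => shifted lam) ?_ ?_ ?_ (fun _ _ => rfl)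
  · intro lam h
    simp only [partitions, Finset.mem_filter, Fintype.mem_piFinset, Finset.mem_range] at h ⊢
    refine ⟨fun j => ?_, fun i j hij => ?_⟩
    · have := h.1 j
      unfold shifted
      omega
    · have h1 := h.2 hij.le
      have h2 : (i : ℕ) < j := hij
      have h3 := j.isLt
      unfold shifted
      omega
  · intro lam _ lam' _ h
    funext j
    have := congrFun h j
    unfold shifted at this
    omega
  · intro k hk
    simp only [Finset.mem_filter, Fintype.mem_piFinset, Finset.mem_range] at hk
    have hanti := antitone_add_val_of_strictAnti hk.2
    -- Comparison with the last entry; this makes the natural subtraction in the inverse map exact.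
    have hlow : ∀ j : Fin n, n - 1 - (j : ℕ) ≤ k j := by
      intro j
      have h1 : j ≤ ⟨n - 1, by omega⟩ := by
        rw [Fin.le_def]; have := j.isLt; simp only; omega
      have := hanti h1
      simp only at this
      omega
    have hup : ∀ j : Fin n, k j + (j : ℕ) < m + n := by
      intro j
      have h1 : (⟨0, by omega⟩ : Fin n) ≤ j := by
        rw [Fin.le_def]; simp
      have h2 := hanti h1
      have h3 := hk.1 ⟨0, by omega⟩
      simp only at h2
      omega
    refine ⟨fun j => k j - (n - 1 - j), ?_, ?_⟩
    · simp only [partitions, Finset.mem_filter, Fintype.mem_piFinset, Finset.mem_range]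
      refine ⟨fun j => ?_, fun i j hij => ?_⟩
      · have := hup j
        have := j.isLt
        omega
      · have h1 := hanti hij
        have h2 := hlow i
        have h3 := hlow j
        have h4 := i.isLt
        have h5 := j.isLt
        simp only at h1 ⊢
        omega
    · funext j
      exact Nat.sub_add_cancel (hlow j)

end Partitions

/-! ### Assembly of the cubature rule -/

lemma ratFun_mul_density {d n : ℕ} (a : Fin d → ℂ) (εp εm : ℕ) (f : MvPolynomial (Fin n) ℂ)
    (θ : Fin n → ℝ) :
    ratFun a f θ * (density εp εm θ : ℂ)
      = MvPolynomial.eval (fun j => (Real.cos (θ j) : ℂ)) (f * vandermondeSq n)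
        * ∏ j, singleDensity a εp εm (θ j) := by
  have hV : MvPolynomial.eval (fun j => (Real.cos (θ j) : ℂ)) (vandermondeSq n)
      = ((∏ j, ∏ k ∈ Finset.Ioi j, (Real.cos (θ j) - Real.cos (θ k)) ^ 2 : ℝ) : ℂ) := by
    simp [vandermondeSq]
  simp only [ratFun, density, singleDensity, Finset.prod_div_distrib, map_mul, hV]
  rw [Finset.prod_comm, Complex.ofReal_mul, Complex.ofReal_prod]
  ring

end JacobiCubature

end

theorem theorem3p1 (m n : ℕ) (hn : 1 ≤ n) (εp εm ηp ηm : ℕ)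
    (hεp : εp ∈ ({0, 1} : Set ℕ)) (hεm : εm ∈ ({0, 1} : Set ℕ))
    (hηp : ηp ∈ ({0, 1} : Set ℕ)) (hηm : ηm ∈ ({0, 1} : Set ℕ))
    (d d' : ℕ) (a : Fin d → ℂ) (a' : Fin d' → ℂ)
    (ha : ∀ r, ‖a r‖ < 1) (ha' : ∀ r, ‖a' r‖ < 1)
    (hconj : JacobiCubature.ConjInvariant a) (hconj' : JacobiCubature.ConjInvariant a')
    (hmn : (m : ℤ) + n - 1 >
      ⌈JacobiCubature.halfDefect d εp εm⌉ + ⌈JacobiCubature.halfDefect d' ηp ηm⌉) :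
    ∃ ξ : ℕ → ℝ,
      (∀ l < m + n, ∀ x : ℝ,
        JacobiCubature.NodeEq a a' εp εm ηp ηm (m + n) l x ↔ x = ξ l) ∧
      (∀ l < m + n, 0 ≤ ξ l ∧ ξ l ≤ Real.pi) ∧
      (∀ k l, k < l → l < m + n → ξ k < ξ l) ∧
      ∀ f : MvPolynomial (Fin n) ℂ,
        JacobiCubature.SymPolyDegLE (2 * (m : ℤ) + ηp + ηm - d' - 1) f →
        (1 / ((2 * (Real.pi : ℂ)) ^ n * (n.factorial : ℂ))) *
            ∫ θ in Set.univ.pi (fun _ : Fin n => Set.Icc (0 : ℝ) Real.pi),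
              JacobiCubature.ratFun a f θ * (JacobiCubature.density εp εm θ : ℂ) =
          ∑ lam ∈ JacobiCubature.partitions m n,
            JacobiCubature.ratFun a f (fun j => ξ (JacobiCubature.shifted lam j)) *
              (JacobiCubature.density εp εm
                (fun j => ξ (JacobiCubature.shifted lam j)) : ℂ) *
              ∏ j, JacobiCubature.weight a a' εp εm ηp ηm (m + n)
                (JacobiCubature.shifted lam j) (ξ (JacobiCubature.shifted lam j)) := by
  open JacobiCubature in
  classical
  replace hεp : εp ≤ 1 := by rcases hεp with h | h <;> simp_all
  replace hεm : εm ≤ 1 := by rcases hεm with h | h <;> simp_all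
  replace hηp : ηp ≤ 1 := by rcases hηp with h | h <;> simp_all
  replace hηm : ηm ≤ 1 := by rcases hηm with h | h <;> simp_all
  -- The strict inequality between integers gives d_ε + d̃_ε̃ ≤ m + n - 2, that is, M ≥ 2.
  obtain ⟨M, hM, hM0⟩ : ∃ M : ℕ, M + d + d' + 2 = 2 * (m + n) + εp + εm + ηp + ηm ∧ 0 < M := by
    have h1 := Int.le_ceil (halfDefect d εp εm)
    have h2 := Int.le_ceil (halfDefect d' ηp ηm)
    have h3 : (⌈halfDefect d εp εm⌉ : ℝ) + ⌈halfDefect d' ηp ηm⌉ + 1 ≤ (m : ℝ) + n - 1 := by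
      exact_mod_cast Int.add_one_le_of_lt hmn
    unfold halfDefect at *
    have h4 : (d : ℝ) + d' + 4 ≤ 2 * (m + n) + εp + εm + ηp + ηm := by linarith
    have h5 : d + d' + 4 ≤ 2 * (m + n) + εp + εm + ηp + ηm := by exact_mod_cast h4
    exact ⟨2 * (m + n) + εp + εm + ηp + ηm - (d + d' + 2), by omega, by omega⟩
  have hb := norm_sumElim_lt ha ha'
  have hmono := strictMono_phase hb hM0
  choose t ht using fun l : ℤ => surjective_phase hb hM0 (Real.pi * (2 * (l : ℝ) + (εm + ηm : ℕ)))
  have hpi := Real.pi_pos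
  refine ⟨fun l => t l, ?_, ?_, ?_, ?_⟩
  · intro l _ x
    rw [nodeEq_iff ha ha' hconj hconj' hM, ← Int.cast_natCast l, ← ht l, hmono.injective.eq_iff]
  · intro l hl
    rw [← hmono.le_iff_le, ← hmono.le_iff_le (b := Real.pi), ht, phase_zero, phase_pi hb]
    refine ⟨by push_cast; positivity, mul_le_mul_of_nonneg_left ?_ hpi.le⟩
    have : 2 * l + (εm + ηm) ≤ M + Fintype.card (Fin d ⊕ Fin d') := by
      simp only [Fintype.card_sum, Fintype.card_fin]
      omega
    exact_mod_cast this
  · intro k l hkl _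
    simp only
    rw [← hmono.lt_iff_lt, ht, ht]
    have : (k : ℝ) < l := by exact_mod_cast hkl
    push_cast
    nlinarith
  · rintro f ⟨hsym, hdeg⟩
    set w : ℕ → ℂ := fun l => weight a a' εp εm ηp ηm (m + n) l (t l) with hw
    -- The bound is the degree allowed for f plus the 2(n - 1) of the squared Vandermonde. The
    -- subtraction does not truncate, because the degree bound on f forces 2m + ηp + ηm - d' - 1 ≥
    -- 0.
    have hquad : ∀ k ≤ 2 * (m + n) + ηp + ηm - d' - 3,
        1 / (2 * Real.pi : ℂ) * ∫ θ in (0 : ℝ)..Real.pi,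
          (Real.cos θ : ℂ) ^ k * singleDensity a εp εm θ
        = ∑ l ∈ Finset.range (m + n),
          (Real.cos (t l) : ℂ) ^ k * singleDensity a εp εm (t l) * w l := by
      intro k hk
      have hD := hdeg ⟨0, by omega⟩
      have h := interval_quadrature ha ha' hconj hconj' hM hM0 (by omega) hεp hεm hηp hηm t ht
        (Polynomial.X ^ k) (by rw [Polynomial.natDegree_X_pow]; omega)
      simpa only [Polynomial.eval_pow, Polynomial.eval_X] using h
    have hprod := product_quadrature (continuous_singleDensity ha εp εm) (t := fun l => t l) hquad
      (f * vandermondeSq n) (fun j => by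
        have h1 := MvPolynomial.degreeOf_mul_le j f (vandermondeSq n)
        have h2 := degreeOf_vandermondeSq_le j
        have h3 := hdeg j
        omega)
    set Φ : (Fin n → ℕ) → ℂ := fun k =>
      MvPolynomial.eval (fun j => (Real.cos (t (k j)) : ℂ)) (f * vandermondeSq n)
        * ∏ j, singleDensity a εp εm (t (k j)) * w (k j) with hΦ
    have hΦs : ∀ k (σ : Equiv.Perm (Fin n)), Φ (k ∘ σ) = Φ k := by
      intro k σ
      have h1 := eval_vandermondeSq_comp_perm (fun j => (Real.cos (t (k j)) : ℂ)) σ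
      have h2 : MvPolynomial.eval ((fun j => (Real.cos (t (k j)) : ℂ)) ∘ σ) f
          = MvPolynomial.eval (fun j => (Real.cos (t (k j)) : ℂ)) f := by
        rw [← MvPolynomial.eval_rename, hsym σ]
      have h3 := Equiv.prod_comp σ fun j => singleDensity a εp εm (t (k j)) * w (k j)
      simp only [hΦ, map_mul, Function.comp_apply]
      rw [h3]
      simp only [Function.comp_def] at h1 h2
      rw [h1, h2]
    have hΦ0 : ∀ k, ¬ Function.Injective k → Φ k = 0 := by
      intro k hk
      have : ¬ Function.Injective fun j => (Real.cos (t (k j)) : ℂ) := by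
        contrapose hk
        exact fun i j hij => hk (by simp only [hij])
      simp only [hΦ, map_mul, eval_vandermondeSq_eq_zero this, mul_zero, zero_mul]
    have hsum := sum_piFinset_eq_factorial_mul (N := m + n) Φ hΦs hΦ0
    rw [← sum_partitions_shifted hn Φ] at hsum
    have hfac : (n.factorial : ℂ) ≠ 0 := by exact_mod_cast n.factorial_ne_zero
    simp_rw [ratFun_mul_density]
    have e : 1 / ((2 * (Real.pi : ℂ)) ^ n * (n.factorial : ℂ))
        = (n.factorial : ℂ)⁻¹ * (1 / (2 * Real.pi : ℂ)) ^ n := by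
      rw [one_div, one_div, mul_inv, inv_pow, mul_comm]
    rw [e, mul_assoc, hprod, hsum, inv_mul_cancel_left₀ hfac]
    refine Finset.sum_congr rfl fun lam _ => ?_
    simp only [hΦ, hw, Finset.prod_mul_distrib, mul_assoc]
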